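/- **Theorem (Progress for Nomos).** We work in the core calculus of Nomos: resource-aware session-typed processes over a functional language with potential annotations (lists $L^q(\tau)$, contextual monads $\{A \leftarrow \overline{A_i}\,;\,\overline{D_j}\}_m$). Channels $c_m$ carry a mode $m$: purely linear ($\mathsf R$), shared ($\mathsf S$), linear phase of a shared channel ($\mathsf L$), or client/transaction ($\mathsf C$). A configuration $\Omega$ is a finite multiset of processes $\mathsf{proc}(c_m, w, P)$ ($P$ provides $c_m$ and has done work $w$) and messages $\mathsf{msg}(c_m, w, M)$. Write $\Omega \mapsto \Omega'$ for the asynchronous, cost-counting multiset-rewriting semantics, in which a process whose next action needs the value of an expression evaluates it by call-by-value small steps. Fix a signature $\Sigma$ of (possibly recursive) contractive type definitions and well-typed function definitions. Write $\Gamma_0 \models^{E} \Omega :: (\Gamma ; \Delta)$ if $\Omega$ is well-typed with energy $E$, where $\Gamma_0$ assigns types to the shared channels that processes may refer to, $\Gamma$ lists the shared channels $a_{\mathsf S}$ that some process of $\Omega$ provides (in shared mode as $a_{\mathsf S}$ or in linear mode as $a_{\mathsf L}$), and $\Delta$ lists the linear channels that $\Omega$ offers to the outside; every linear channel that an object of $\Omega$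 uses is provided inside $\Omega$. Suppose that * $\Omega$ is well-typed: $\Gamma_0 \models^{E} \Omega :: (\Gamma ; \Delta)$; * $\Omega$ is well-formed: no channel occurs twice in $\Gamma_0$, in $\Gamma$ or in $\Delta$, no two objects of $\Omega$ provide the same channel, and $\Gamma \subseteq \Gamma_0$; * $\Omega$ is closed: every shared channel of $\Gamma_0$ is provided in $\Omega$, that is, $\Gamma_0 \subseteq \Gamma$. Then at least one of the following holds. 1. Every object of $\Omega$ is poised. Here a process $\mathsf{proc}(c_m, w, P)$ is poised if $P$ is a negative forwarder $c_m \leftarrow^{-} d_m$, or waits to receive a label, a channel, a value or potential along its own channel $c_m$, or accepts along its own channel $c_m = a_{\mathsf S}$, or detaches from its own channel $c_m = a_{\mathsf L}$. A message $\mathsf{msg}(c_m, w, M)$ is poised if $M$ sends a label, a channel, a value, potential, or the closing signal along the channel $c_m$ that it provides. 2. $\Omega \mapsto \Omega'$ for some configuration $\Omega'$. 3. There is a shared channel $a_{\mathsf S}$ such that some process of $\Omega$ is trying to acquire $a_{\mathsf S}$ (it has the form $y_{\mathsf L} \leftarrow \mathsf{acquire}\ a_{\mathsf S}\,;\,Q$),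 while the contract providing $a_{\mathsf S}$ is held in linear mode: $\mathsf{proc}(a_{\mathsf L}, w, P) \in \Omega$ for some $w$ and $P$, where $a_{\mathsf L}$ is the linear counterpart of $a_{\mathsf S}$ or one of the continuation channels of it. -/

import Mathlib

namespace Nomos

/-! ## Modes, channels -/

/-- `R`: purely linear, `S`: shared, `L`: a shared channel in its linear phase,
`C`: linear channel of a client (transaction). -/
inductive Mode
  | R | S | L | C
  deriving DecidableEq

/-- Identifiers of channels.  `var x` is a bound channel variable; `name a k` is a run-time channel,
the `k`-th continuation of the channel with base name `a`. -/
inductive Ident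
  | var (x : ℕ)
  | name (a k : ℕ)
  deriving DecidableEq

/-- A channel `c_m`. -/
structure Chan where
  id : Ident
  mode : Mode
  deriving DecidableEq

/-- The run-time channel with base name `a`, continuation stamp `k` and mode `m`. -/
abbrev ch (a k : ℕ) (m : Mode) : Chan := ⟨.name a k, m⟩

/-- The run-time shared channel `a_S`.  Its linear counterpart `a_L`, or any of the continuations
`a_L⁺`, `a_L⁺⁺`, … of it in the course of a session, is `ch a k .L` for some `k`. -/
abbrev sh (a : ℕ) : Chan := ch a 0 .S

/-- The channel variable `x_m`. -/
abbrev va (x : ℕ) (m : Mode) : Chan := ⟨.var x, m⟩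

/-- Polarity of a forwarder: `pos` is `x ←⁺ y`, `neg` is `x ←⁻ y`. -/
inductive Pol
  | pos | neg
  deriving DecidableEq

/-! ## Types -/

mutual
/-- Functional types. `name t` is a type name of the signature; `list q τ` is `L^q(τ)`;
`proc m A As Ds` is the contextual monadic type `{A ← As ; Ds}_m` (for `m = R` the list `As` of
shared types is empty). -/
inductive FType
  | name (t : ℕ)
  | int
  | bool
  | arr (σ τ : FType)
  | sum (σ τ : FType)
  | prod (σ τ : FType)
  | list (q : ℕ) (τ : FType)
  | proc (m : Mode) (A : SType) (As : List SType) (Ds : List (Mode × SType))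
/-- Session types (all layers together, see `InLang` for the grammars of the four modes). -/
inductive SType
  | name (V : ℕ)
  | ichoice (L : Finset ℕ) (A : {l : ℕ // l ∈ L} → SType)
  | echoice (L : Finset ℕ) (A : {l : ℕ // l ∈ L} → SType)
  | tensor (n : Mode) (A B : SType)
  | lolli (n : Mode) (A B : SType)
  | one
  | varrow (τ : FType) (A : SType)
  | vtimes (τ : FType) (A : SType)
  | paypot (r : ℕ) (A : SType)
  | getpot (r : ℕ) (A : SType)
  | up (A : SType)
  | down (A : SType)
end

/-! ## Terms -/

mutual
/-- Expressions of the functional layer. `fn f` refers to a function definition of the signature,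
`mon m x ys zs P` is the monadic value `{x_m ← P ← ys ; zs}`, in which `x_m`, the shared variables
`ys` and the linear variables `zs` are bound. -/
inductive Exp
  | var (x : ℕ)
  | fn (f : ℕ)
  | lam (x : ℕ) (τ : FType) (M : Exp)
  | app (M N : Exp)
  | inl (M : Exp)
  | inr (M : Exp)
  | case (M : Exp) (x : ℕ) (Ml : Exp) (y : ℕ) (Mr : Exp)
  | pair (M N : Exp)
  | fst (M : Exp)
  | snd (M : Exp)
  | int (n : ℤ)
  | bool (b : Bool)
  | ite (M Mt Mf : Exp)
  | arith (o : ℤ → ℤ → ℤ) (M N : Exp)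
  | comp (o : ℤ → ℤ → Bool) (M N : Exp)
  | nil
  | cons (M N : Exp)
  | lmatch (M M₁ : Exp) (x xs : ℕ) (M₂ : Exp)
  | tick (r : ℕ) (M : Exp)
  | mon (m : Mode) (x : ℕ) (ys : List ℕ) (zs : List (ℕ × Mode)) (P : Proc)
/-- Processes.
* `spawn m x M as ds Q` is `x_m ← M ← as ; ds ; Q`, binding `x_m` in `Q`;
* `tail x M as ds` is the tail call `x ← M ← as ; ds`, by which the provider of `x` continues as the
  process computed by `M` (the last line of a recursive process definition);
* `fwd p x y` is `x ←ᵖ y`;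
* `sendLabel x k P` is `x.k ; P` and `case x L Q` is `case x (l ⇒ Q_l)_{l ∈ L}`;
* `sendCh x w P`, `recvCh x y n P` (binding `y_n`), `sendVal x M P`, `recvVal x y P` (binding the
  functional variable `y`) send and receive channels and values;
* `acquire y x P` is `y_L ← acquire x ; P`, `accept y x P` is `y_L ← accept x ; P`, both binding
  `y_L`; `detach y x P` and `release y x P` are `y_S ← detach x ; P`, `y_S ← release x ; P`, both
  binding `y_S`. -/
inductive Proc
  | spawn (m : Mode) (x : ℕ) (M : Exp) (as ds : List Chan) (Q : Proc)
  | tail (x : Chan) (M : Exp) (as ds : List Chan)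
  | fwd (p : Pol) (x y : Chan)
  | sendLabel (x : Chan) (k : ℕ) (P : Proc)
  | case (x : Chan) (L : Finset ℕ) (Q : {l : ℕ // l ∈ L} → Proc)
  | sendCh (x w : Chan) (P : Proc)
  | recvCh (x : Chan) (y : ℕ) (n : Mode) (P : Proc)
  | sendVal (x : Chan) (M : Exp) (P : Proc)
  | recvVal (x : Chan) (y : ℕ) (P : Proc)
  | close (x : Chan)
  | wait (x : Chan) (P : Proc)
  | work (r : ℕ) (P : Proc)
  | get (x : Chan) (r : ℕ) (P : Proc)
  | pay (x : Chan) (r : ℕ) (P : Proc)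
  | acquire (y : ℕ) (x : Chan) (P : Proc)
  | accept (y : ℕ) (x : Chan) (P : Proc)
  | detach (y : ℕ) (x : Chan) (P : Proc)
  | release (y : ℕ) (x : Chan) (P : Proc)
end

/-- Content of a message: a label, a channel, a value or some potential. -/
inductive Payload
  | label (k : ℕ)
  | chan (w : Chan)
  | val (N : Exp)
  | pot (r : ℕ)

/-- Messages.  In `msg c w M`:
* `M = out pl c'` is "send `pl` along `c`; `c ← c'`", a message from the provider `c'` to the
  client of `c`;
* `M = inn pl e` is "send `pl` along `e`; `c ← e`", a message from the client of `c` to the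
  provider of `e`;
* `M = close` is "close `c`". -/
inductive Msg
  | out (pl : Payload) (c' : Chan)
  | inn (pl : Payload) (e : Chan)
  | close

/-- The semantic objects `proc(c_m, w, P)` and `msg(c_m, w, M)`. -/
inductive Obj
  | proc (c : Chan) (w : ℕ) (P : Proc)
  | msg (c : Chan) (w : ℕ) (M : Msg)

/-- Configurations are multisets of such objects. -/
abbrev Cfg := Multiset Obj

/-- A signature: definitions of session type names, of functional type names and of functions;
`fn f = some (M, τ, p)` stands for `f = M : τ`, where `f` needs potential `p`. -/
structure Sig where
  stype : ℕ → Option SType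
  ftype : ℕ → Option FType
  fn : ℕ → Option (Exp × FType × ℕ)

/-! ## Substitution

Only run-time channels are substituted for channels and only closed values for functional
variables, so that no variable can be captured. -/

/-- `c[new/old]` -/
def Chan.subst (c old new : Chan) : Chan := if c = old then new else c

mutual
/-- `M[new/old]`, for channels -/
def Exp.substC (old new : Chan) : Exp → Exp
  | .var x => .var x
  | .fn f => .fn f
  | .lam x τ M => .lam x τ (M.substC old new)
  | .app M N => .app (M.substC old new) (N.substC old new)
  | .inl M => .inl (M.substC old new)
  | .inr M => .inr (M.substC old new)
  | .case M x Ml y Mr => .case (M.substC old new) x (Ml.substC old new) y (Mr.substC old new)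
  | .pair M N => .pair (M.substC old new) (N.substC old new)
  | .fst M => .fst (M.substC old new)
  | .snd M => .snd (M.substC old new)
  | .int n => .int n
  | .bool b => .bool b
  | .ite M Mt Mf => .ite (M.substC old new) (Mt.substC old new) (Mf.substC old new)
  | .arith o M N => .arith o (M.substC old new) (N.substC old new)
  | .comp o M N => .comp o (M.substC old new) (N.substC old new)
  | .nil => .nil
  | .cons M N => .cons (M.substC old new) (N.substC old new)
  | .lmatch M M₁ x xs M₂ => .lmatch (M.substC old new) (M₁.substC old new) x xs (M₂.substC old new)
  | .tick r M => .tick r (M.substC old new)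
  | .mon m x ys zs P =>
      if old = va x m ∨ (∃ y ∈ ys, old = va y .S) ∨ (∃ z ∈ zs, old = va z.1 z.2) then
        .mon m x ys zs P
      else .mon m x ys zs (P.substC old new)
/-- `P[new/old]`, for channels -/
def Proc.substC (old new : Chan) : Proc → Proc
  | .spawn m x M as ds Q =>
      .spawn m x (M.substC old new) (as.map (·.subst old new)) (ds.map (·.subst old new))
        (if old = va x m then Q else Q.substC old new)
  | .tail x M as ds =>
      .tail (x.subst old new) (M.substC old new) (as.map (·.subst old new))
        (ds.map (·.subst old new))
  | .fwd p x y => .fwd p (x.subst old new) (y.subst old new)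
  | .sendLabel x k P => .sendLabel (x.subst old new) k (P.substC old new)
  | .case x L Q => .case (x.subst old new) L (fun l => (Q l).substC old new)
  | .sendCh x w P => .sendCh (x.subst old new) (w.subst old new) (P.substC old new)
  | .recvCh x y n P =>
      .recvCh (x.subst old new) y n (if old = va y n then P else P.substC old new)
  | .sendVal x M P => .sendVal (x.subst old new) (M.substC old new) (P.substC old new)
  | .recvVal x y P => .recvVal (x.subst old new) y (P.substC old new)
  | .close x => .close (x.subst old new)
  | .wait x P => .wait (x.subst old new) (P.substC old new)
  | .work r P => .work r (P.substC old new)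
  | .get x r P => .get (x.subst old new) r (P.substC old new)
  | .pay x r P => .pay (x.subst old new) r (P.substC old new)
  | .acquire y x P =>
      .acquire y (x.subst old new) (if old = va y .L then P else P.substC old new)
  | .accept y x P =>
      .accept y (x.subst old new) (if old = va y .L then P else P.substC old new)
  | .detach y x P =>
      .detach y (x.subst old new) (if old = va y .S then P else P.substC old new)
  | .release y x P =>
      .release y (x.subst old new) (if old = va y .S then P else P.substC old new)
end

mutual
/-- `M[V/v]`, for a functional variable `v` -/
def Exp.substV (M : Exp) (v : ℕ) (V : Exp) : Exp :=
  match M with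
  | .var x => if x = v then V else .var x
  | .fn f => .fn f
  | .lam x τ M => .lam x τ (if x = v then M else M.substV v V)
  | .app M N => .app (M.substV v V) (N.substV v V)
  | .inl M => .inl (M.substV v V)
  | .inr M => .inr (M.substV v V)
  | .case M x Ml y Mr =>
      .case (M.substV v V) x (if x = v then Ml else Ml.substV v V)
        y (if y = v then Mr else Mr.substV v V)
  | .pair M N => .pair (M.substV v V) (N.substV v V)
  | .fst M => .fst (M.substV v V)
  | .snd M => .snd (M.substV v V)
  | .int n => .int n
  | .bool b => .bool b
  | .ite M Mt Mf => .ite (M.substV v V) (Mt.substV v V) (Mf.substV v V)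
  | .arith o M N => .arith o (M.substV v V) (N.substV v V)
  | .comp o M N => .comp o (M.substV v V) (N.substV v V)
  | .nil => .nil
  | .cons M N => .cons (M.substV v V) (N.substV v V)
  | .lmatch M M₁ x xs M₂ =>
      .lmatch (M.substV v V) (M₁.substV v V) x xs
        (if x = v ∨ xs = v then M₂ else M₂.substV v V)
  | .tick r M => .tick r (M.substV v V)
  | .mon m x ys zs P => .mon m x ys zs (P.substV v V)
/-- `P[V/v]`, for a functional variable `v` -/
def Proc.substV (P : Proc) (v : ℕ) (V : Exp) : Proc :=
  match P with
  | .spawn m x M as ds Q => .spawn m x (M.substV v V) as ds (Q.substV v V)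
  | .tail x M as ds => .tail x (M.substV v V) as ds
  | .fwd p x y => .fwd p x y
  | .sendLabel x k P => .sendLabel x k (P.substV v V)
  | .case x L Q => .case x L (fun l => (Q l).substV v V)
  | .sendCh x w P => .sendCh x w (P.substV v V)
  | .recvCh x y n P => .recvCh x y n (P.substV v V)
  | .sendVal x M P => .sendVal x (M.substV v V) (P.substV v V)
  | .recvVal x y P => .recvVal x y (if y = v then P else P.substV v V)
  | .close x => .close x
  | .wait x P => .wait x (P.substV v V)
  | .work r P => .work r (P.substV v V)
  | .get x r P => .get x r (P.substV v V)
  | .pay x r P => .pay x r (P.substV v V)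
  | .acquire y x P => .acquire y x (P.substV v V)
  | .accept y x P => .accept y x (P.substV v V)
  | .detach y x P => .detach y x (P.substV v V)
  | .release y x P => .release y x (P.substV v V)
end

/-- Successive substitution of channels for channels; for variables replaced by run-time channels
it is simultaneous substitution. -/
def Proc.substAll (P : Proc) (l : List (Chan × Chan)) : Proc :=
  l.foldl (fun Q p => Q.substC p.1 p.2) P

def Payload.subst (old new : Chan) : Payload → Payload
  | .label k => .label k
  | .chan w => .chan (w.subst old new)
  | .val N => .val (N.substC old new)
  | .pot r => .pot r

def Msg.subst (old new : Chan) : Msg → Msg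
  | .out pl c' => .out (pl.subst old new) (c'.subst old new)
  | .inn pl e => .inn (pl.subst old new) (e.subst old new)
  | .close => .close

/-! ## Channels occurring in a term, fresh channels -/

mutual
def Exp.chans : Exp → Finset Chan
  | .var _ => ∅
  | .fn _ => ∅
  | .lam _ _ M => M.chans
  | .app M N => M.chans ∪ N.chans
  | .inl M => M.chans
  | .inr M => M.chans
  | .case M _ Ml _ Mr => M.chans ∪ Ml.chans ∪ Mr.chans
  | .pair M N => M.chans ∪ N.chans
  | .fst M => M.chans
  | .snd M => M.chans
  | .int _ => ∅
  | .bool _ => ∅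
  | .ite M Mt Mf => M.chans ∪ Mt.chans ∪ Mf.chans
  | .arith _ M N => M.chans ∪ N.chans
  | .comp _ M N => M.chans ∪ N.chans
  | .nil => ∅
  | .cons M N => M.chans ∪ N.chans
  | .lmatch M M₁ _ _ M₂ => M.chans ∪ M₁.chans ∪ M₂.chans
  | .tick _ M => M.chans
  | .mon _ _ _ _ P => P.chans
def Proc.chans : Proc → Finset Chan
  | .spawn _ _ M as ds Q => M.chans ∪ as.toFinset ∪ ds.toFinset ∪ Q.chans
  | .tail x M as ds => {x} ∪ M.chans ∪ as.toFinset ∪ ds.toFinset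
  | .fwd _ x y => {x, y}
  | .sendLabel x _ P => {x} ∪ P.chans
  | .case x _ Q => {x} ∪ Finset.univ.biUnion (fun l => (Q l).chans)
  | .sendCh x w P => {x, w} ∪ P.chans
  | .recvCh x _ _ P => {x} ∪ P.chans
  | .sendVal x M P => {x} ∪ M.chans ∪ P.chans
  | .recvVal x _ P => {x} ∪ P.chans
  | .close x => {x}
  | .wait x P => {x} ∪ P.chans
  | .work _ P => P.chans
  | .get x _ P => {x} ∪ P.chans
  | .pay x _ P => {x} ∪ P.chans
  | .acquire _ x P => {x} ∪ P.chans
  | .accept _ x P => {x} ∪ P.chans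
  | .detach _ x P => {x} ∪ P.chans
  | .release _ x P => {x} ∪ P.chans
end

def Payload.chans : Payload → Finset Chan
  | .label _ => ∅
  | .chan w => {w}
  | .val N => N.chans
  | .pot _ => ∅

/-- The channels that a message uses (apart from the one that it provides). -/
def Msg.used : Msg → Finset Chan
  | .out pl c' => {c'} ∪ pl.chans
  | .inn pl e => {e} ∪ pl.chans
  | .close => ∅

def Obj.chans : Obj → Finset Chan
  | .proc c _ P => {c} ∪ P.chans
  | .msg c _ M => {c} ∪ M.used

/-- The channel provided by an object. -/
def Obj.provides : Obj → Chan
  | .proc c _ _ => c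
  | .msg c _ _ => c

/-- `c` does not occur in `Ω`. -/
def Fresh (c : Chan) (Ω : Cfg) : Prop := ∀ o ∈ Ω, c ∉ o.chans

/-- No channel with base name `a`, at whatever mode, occurs in `Ω`. -/
def FreshBase (a : ℕ) (Ω : Cfg) : Prop := ∀ k m, Fresh (ch a k m) Ω

/-! ## Equi-recursive types -/

/-- Replace a type name by its definition. -/
def Sig.unfold (Sg : Sig) : SType → SType
  | .name V => (Sg.stype V).getD (.name V)
  | A => A

/-- Replace a functional type name by its definition. -/
def Sig.unfoldF (Sg : Sig) : FType → FType
  | .name t => (Sg.ftype t).getD (.name t)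
  | τ => τ

/-- Same head constructor, with related components. -/
inductive FHead (RF : FType → FType → Prop) (RS : SType → SType → Prop) : FType → FType → Prop
  | name (t) : FHead RF RS (.name t) (.name t)
  | int : FHead RF RS .int .int
  | bool : FHead RF RS .bool .bool
  | arr {σ σ' τ τ'} : RF σ σ' → RF τ τ' → FHead RF RS (.arr σ τ) (.arr σ' τ')
  | sum {σ σ' τ τ'} : RF σ σ' → RF τ τ' → FHead RF RS (.sum σ τ) (.sum σ' τ')
  | prod {σ σ' τ τ'} : RF σ σ' → RF τ τ' → FHead RF RS (.prod σ τ) (.prod σ' τ')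
  | list {q τ τ'} : RF τ τ' → FHead RF RS (.list q τ) (.list q τ')
  | proc {m A A' As As' Ds Ds'} : RS A A' → List.Forall₂ RS As As' →
      List.Forall₂ (fun D D' => D.1 = D'.1 ∧ RS D.2 D'.2) Ds Ds' →
      FHead RF RS (.proc m A As Ds) (.proc m A' As' Ds')

/-- Same head constructor, with related components. -/
inductive SHead (RF : FType → FType → Prop) (RS : SType → SType → Prop) : SType → SType → Prop
  | name (V) : SHead RF RS (.name V) (.name V)
  | ichoice {L A A'} : (∀ l, RS (A l) (A' l)) → SHead RF RS (.ichoice L A) (.ichoice L A')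
  | echoice {L A A'} : (∀ l, RS (A l) (A' l)) → SHead RF RS (.echoice L A) (.echoice L A')
  | tensor {n A A' B B'} : RS A A' → RS B B' → SHead RF RS (.tensor n A B) (.tensor n A' B')
  | lolli {n A A' B B'} : RS A A' → RS B B' → SHead RF RS (.lolli n A B) (.lolli n A' B')
  | one : SHead RF RS .one .one
  | varrow {τ τ' A A'} : RF τ τ' → RS A A' → SHead RF RS (.varrow τ A) (.varrow τ' A')
  | vtimes {τ τ' A A'} : RF τ τ' → RS A A' → SHead RF RS (.vtimes τ A) (.vtimes τ' A')
  | paypot {r A A'} : RS A A' → SHead RF RS (.paypot r A) (.paypot r A')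
  | getpot {r A A'} : RS A A' → SHead RF RS (.getpot r A) (.getpot r A')
  | up {A A'} : RS A A' → SHead RF RS (.up A) (.up A')
  | down {A A'} : RS A A' → SHead RF RS (.down A) (.down A')

/-- A pair of relations that is consistent with unfolding the types. -/
structure Bisim (Sg : Sig) (RF : FType → FType → Prop) (RS : SType → SType → Prop) : Prop where
  ftype : ∀ τ σ, RF τ σ → FHead RF RS (Sg.unfoldF τ) (Sg.unfoldF σ)
  stype : ∀ A B, RS A B → SHead RF RS (Sg.unfold A) (Sg.unfold B)

/-- Equi-recursive equality of functional types: the infinite unfoldings agree. -/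
def FEq (Sg : Sig) (τ σ : FType) : Prop := ∃ RF RS, Bisim Sg RF RS ∧ RF τ σ

/-- Equi-recursive equality of session types: the infinite unfoldings agree. -/
def SEq (Sg : Sig) (A B : SType) : Prop := ∃ RF RS, Bisim Sg RF RS ∧ RS A B

/-- One step in the grammar of the session types at mode `m`. -/
inductive LangHead (X : Mode → SType → Prop) : Mode → SType → Prop
  | ichoice {m L A} : m ≠ .S → (∀ l, X m (A l)) → LangHead X m (.ichoice L A)
  | echoice {m L A} : m ≠ .S → (∀ l, X m (A l)) → LangHead X m (.echoice L A)
  | tensor {m n A B} : m ≠ .S → X n A → X m B → LangHead X m (.tensor n A B)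
  | lolli {m n A B} : m ≠ .S → X n A → X m B → LangHead X m (.lolli n A B)
  | one {m} : m ≠ .S → LangHead X m .one
  | varrow {m τ A} : m ≠ .S → X m A → LangHead X m (.varrow τ A)
  | vtimes {m τ A} : m ≠ .S → X m A → LangHead X m (.vtimes τ A)
  | paypot {m r A} : m ≠ .S → X m A → LangHead X m (.paypot r A)
  | getpot {m r A} : m ≠ .S → X m A → LangHead X m (.getpot r A)
  | down {A} : X .S A → LangHead X .L (.down A)
  | up {A} : X .L A → LangHead X .S (.up A)

/-- `A` belongs to the language of the grammar of `A_m` (read coinductively, since types are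
equi-recursive). -/
def InLang (Sg : Sig) (m : Mode) (A : SType) : Prop :=
  ∃ X : Mode → SType → Prop, X m A ∧ ∀ n B, X n B → LangHead X n (Sg.unfold B)

/-- One step of the rules for equi-synchronizing types. -/
inductive EsyncHead (Sg : Sig) (X : SType → SType → Prop) : SType → SType → Prop
  | ichoice {L A C} : (∀ l, X (A l) C) → EsyncHead Sg X (.ichoice L A) C
  | echoice {L A C} : (∀ l, X (A l) C) → EsyncHead Sg X (.echoice L A) C
  | tensor {n A B C} : X B C → EsyncHead Sg X (.tensor n A B) C
  | lolli {n A B C} : X B C → EsyncHead Sg X (.lolli n A B) C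
  | varrow {τ A C} : X A C → EsyncHead Sg X (.varrow τ A) C
  | vtimes {τ A C} : X A C → EsyncHead Sg X (.vtimes τ A) C
  | paypot {r A C} : X A C → EsyncHead Sg X (.paypot r A) C
  | getpot {r A C} : X A C → EsyncHead Sg X (.getpot r A) C
  | up {A C} : SEq Sg (.up A) C → X A C → EsyncHead Sg X (.up A) C
  | down {A C} : SEq Sg A C → X A C → EsyncHead Sg X (.down A) C

/-- `(A, C) esync` (coinductively). -/
def Esync (Sg : Sig) (A C : SType) : Prop :=
  ∃ X : SType → SType → Prop, X A C ∧ ∀ B D, X B D → EsyncHead Sg X (Sg.unfold B) D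

/-- Positive types: the provider sends. Negative types: the provider receives. -/
def SType.pol : SType → Option Pol
  | .ichoice _ _ => some .pos
  | .tensor _ _ _ => some .pos
  | .one => some .pos
  | .vtimes _ _ => some .pos
  | .paypot _ _ => some .pos
  | .echoice _ _ => some .neg
  | .lolli _ _ _ => some .neg
  | .varrow _ _ => some .neg
  | .getpot _ _ => some .neg
  | .up _ => none
  | .down _ => none
  | .name _ => none

/-! ## Contexts -/

/-- Functional contexts `Ψ`. -/
abbrev FCtx := ℕ → Option FType
/-- Shared contexts `Γ`; they admit weakening and contraction. -/
abbrev SCtx := Ident → Option SType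
/-- Linear contexts `Δ`. -/
abbrev LCtx := Multiset (Chan × SType)

/-- One step of the sharing relation: potential annotations are split, everything else is
copied. -/
inductive ShareHead (Sg : Sig) (X : FType → FType → FType → Prop) :
    FType → FType → FType → Prop
  | name (t) : ShareHead Sg X (.name t) (.name t) (.name t)
  | int : ShareHead Sg X .int .int .int
  | bool : ShareHead Sg X .bool .bool .bool
  | sum {σ σ₁ σ₂ τ τ₁ τ₂} : X σ σ₁ σ₂ → X τ τ₁ τ₂ →
      ShareHead Sg X (.sum σ τ) (.sum σ₁ τ₁) (.sum σ₂ τ₂)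
  | prod {σ σ₁ σ₂ τ τ₁ τ₂} : X σ σ₁ σ₂ → X τ τ₁ τ₂ →
      ShareHead Sg X (.prod σ τ) (.prod σ₁ τ₁) (.prod σ₂ τ₂)
  | list {q₁ q₂ τ τ₁ τ₂} : X τ τ₁ τ₂ →
      ShareHead Sg X (.list (q₁ + q₂) τ) (.list q₁ τ₁) (.list q₂ τ₂)
  | arr {σ σ₁ σ₂ τ τ₁ τ₂} : FEq Sg (.arr σ τ) (.arr σ₁ τ₁) → FEq Sg (.arr σ τ) (.arr σ₂ τ₂) →
      ShareHead Sg X (.arr σ τ) (.arr σ₁ τ₁) (.arr σ₂ τ₂)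
  | proc {m A As Ds A₁ As₁ Ds₁ A₂ As₂ Ds₂} :
      FEq Sg (.proc m A As Ds) (.proc m A₁ As₁ Ds₁) →
      FEq Sg (.proc m A As Ds) (.proc m A₂ As₂ Ds₂) →
      ShareHead Sg X (.proc m A As Ds) (.proc m A₁ As₁ Ds₁) (.proc m A₂ As₂ Ds₂)

/-- `τ ⋎ (τ₁, τ₂)` (coinductively). -/
def Share (Sg : Sig) (τ τ₁ τ₂ : FType) : Prop :=
  ∃ X : FType → FType → FType → Prop, X τ τ₁ τ₂ ∧
    ∀ σ σ₁ σ₂, X σ σ₁ σ₂ → ShareHead Sg X (Sg.unfoldF σ) (Sg.unfoldF σ₁) (Sg.unfoldF σ₂)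

/-- `Ψ ⋎ (Ψ₁, Ψ₂)`: every variable is shared between `Ψ₁` and `Ψ₂`, or (weakening) left out of one
of them or of both. -/
def CtxShare (Sg : Sig) (Ψ Ψ₁ Ψ₂ : FCtx) : Prop :=
  ∀ x, (Ψ₁ x = none ∧ Ψ₂ x = none) ∨ (Ψ₁ x = Ψ x ∧ Ψ₂ x = none) ∨ (Ψ₁ x = none ∧ Ψ₂ x = Ψ x) ∨
    ∃ τ τ₁ τ₂, Ψ x = some τ ∧ Ψ₁ x = some τ₁ ∧ Ψ₂ x = some τ₂ ∧ Share Sg τ τ₁ τ₂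

/-- The empty contexts. -/
def FCtx.empty : FCtx := fun _ => none
def SCtx.empty : SCtx := fun _ => none

/-- `Ψ, x : τ` -/
def FCtx.ext (Ψ : FCtx) (x : ℕ) (τ : FType) : FCtx := Function.update Ψ x (some τ)
/-- `Γ, x_S : A` for a channel variable `x` -/
def SCtx.ext (Γ : SCtx) (x : ℕ) (A : SType) : SCtx := Function.update Γ (.var x) (some A)
/-- `ys : As` -/
def SCtx.ofList (ys : List ℕ) (As : List SType) : SCtx :=
  (ys.zip As).foldr (fun p Γ => SCtx.ext Γ p.1 p.2) SCtx.empty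
/-- `ds : Ds` -/
def LCtx.ofList (ds : List Chan) (Ds : List (Mode × SType)) : LCtx :=
  ((ds.zip (Ds.map Prod.snd) : List (Chan × SType)) : Multiset (Chan × SType))

/-- `Δ purelin` -/
def PureLin (Δ : LCtx) : Prop := ∀ d ∈ Δ, d.1.mode = .R

/-- The invariants that a process typing judgment `Ψ ; Γ ; Δ ⊢ P :: (x : A)` is subject to,
according to the mode of `x`. Channels in `Δ, x` are distinct, and those in `Δ` are linear. -/
structure Inv (Sg : Sig) (Γ : SCtx) (Δ : LCtx) (x : Chan) (A : SType) : Prop where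
  nodup : (x ::ₘ Δ.map Prod.fst).Nodup
  linear : ∀ d ∈ Δ, d.1.mode ≠ .S
  shared : x.mode = .R → Γ = SCtx.empty
  pure : x.mode = .R ∨ x.mode = .S → PureLin Δ
  lang : InLang Sg x.mode A

/-! ## Typing of expressions and processes -/

mutual
/-- `Ψ ⊢^q M : τ` -/
inductive ExpTyp (Sg : Sig) : FCtx → ℕ → Exp → FType → Prop
  | conv {Ψ q M τ σ} : ExpTyp Sg Ψ q M τ → FEq Sg τ σ → ExpTyp Sg Ψ q M σ
  | relax {Ψ p q M τ} : ExpTyp Sg Ψ p M τ → p ≤ q → ExpTyp Sg Ψ q M τ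
  | var {Ψ x τ} : Ψ x = some τ → ExpTyp Sg Ψ 0 (.var x) τ
  | fn {Ψ f M τ p} : Sg.fn f = some (M, τ, p) → ExpTyp Sg Ψ p (.fn f) τ
  /-- The body of a function may use only variables without potential. -/
  | lam {Ψ Ψ₁ Ψ₂ x σ τ M} : CtxShare Sg Ψ Ψ₁ Ψ₂ → CtxShare Sg Ψ₁ Ψ₁ Ψ₁ →
      ExpTyp Sg (Ψ₁.ext x σ) 0 M τ → ExpTyp Sg Ψ 0 (.lam x σ M) (.arr σ τ)
  | app {Ψ Ψ₁ Ψ₂ p q M N σ τ} : CtxShare Sg Ψ Ψ₁ Ψ₂ → ExpTyp Sg Ψ₁ p M (.arr σ τ) →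
      ExpTyp Sg Ψ₂ q N σ → ExpTyp Sg Ψ (p + q) (.app M N) τ
  | inl {Ψ q M σ τ} : ExpTyp Sg Ψ q M σ → ExpTyp Sg Ψ q (.inl M) (.sum σ τ)
  | inr {Ψ q M σ τ} : ExpTyp Sg Ψ q M τ → ExpTyp Sg Ψ q (.inr M) (.sum σ τ)
  | case {Ψ Ψ₁ Ψ₂ p q M x Ml y Mr σ τ ρ} : CtxShare Sg Ψ Ψ₁ Ψ₂ →
      ExpTyp Sg Ψ₁ p M (.sum σ τ) → ExpTyp Sg (Ψ₂.ext x σ) q Ml ρ →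
      ExpTyp Sg (Ψ₂.ext y τ) q Mr ρ → ExpTyp Sg Ψ (p + q) (.case M x Ml y Mr) ρ
  | pair {Ψ Ψ₁ Ψ₂ p q M N σ τ} : CtxShare Sg Ψ Ψ₁ Ψ₂ → ExpTyp Sg Ψ₁ p M σ →
      ExpTyp Sg Ψ₂ q N τ → ExpTyp Sg Ψ (p + q) (.pair M N) (.prod σ τ)
  | fst {Ψ q M σ τ} : ExpTyp Sg Ψ q M (.prod σ τ) → ExpTyp Sg Ψ q (.fst M) σ
  | snd {Ψ q M σ τ} : ExpTyp Sg Ψ q M (.prod σ τ) → ExpTyp Sg Ψ q (.snd M) τ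
  | int {Ψ n} : ExpTyp Sg Ψ 0 (.int n) .int
  | bool {Ψ b} : ExpTyp Sg Ψ 0 (.bool b) .bool
  | ite {Ψ Ψ₁ Ψ₂ p q M Mt Mf τ} : CtxShare Sg Ψ Ψ₁ Ψ₂ → ExpTyp Sg Ψ₁ p M .bool →
      ExpTyp Sg Ψ₂ q Mt τ → ExpTyp Sg Ψ₂ q Mf τ → ExpTyp Sg Ψ (p + q) (.ite M Mt Mf) τ
  | arith {Ψ Ψ₁ Ψ₂ p q o M N} : CtxShare Sg Ψ Ψ₁ Ψ₂ → ExpTyp Sg Ψ₁ p M .int →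
      ExpTyp Sg Ψ₂ q N .int → ExpTyp Sg Ψ (p + q) (.arith o M N) .int
  | comp {Ψ Ψ₁ Ψ₂ p q o M N} : CtxShare Sg Ψ Ψ₁ Ψ₂ → ExpTyp Sg Ψ₁ p M .int →
      ExpTyp Sg Ψ₂ q N .int → ExpTyp Sg Ψ (p + q) (.comp o M N) .bool
  | nil {Ψ r τ} : ExpTyp Sg Ψ 0 .nil (.list r τ)
  | cons {Ψ Ψ₁ Ψ₂ p q r M N τ} : CtxShare Sg Ψ Ψ₁ Ψ₂ → ExpTyp Sg Ψ₁ p M τ →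
      ExpTyp Sg Ψ₂ q N (.list r τ) → ExpTyp Sg Ψ (p + q + r) (.cons M N) (.list r τ)
  | lmatch {Ψ Ψ₁ Ψ₂ p q r M M₁ x xs M₂ τ σ} : CtxShare Sg Ψ Ψ₁ Ψ₂ → x ≠ xs →
      ExpTyp Sg Ψ₁ p M (.list r τ) → ExpTyp Sg Ψ₂ q M₁ σ →
      ExpTyp Sg ((Ψ₂.ext x τ).ext xs (.list r τ)) (q + r) M₂ σ →
      ExpTyp Sg Ψ (p + q) (.lmatch M M₁ x xs M₂) σ
  | tick {Ψ p r M τ} : ExpTyp Sg Ψ p M τ → ExpTyp Sg Ψ (p + r) (.tick r M) τ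
  /-- `{}I_R`, `{}I_S` and `{}I_C`; for `m = R` the invariants of the premise force `ys` and `As` to
  be empty, for `m = R` and `m = S` they force the channels `zs` to be purely linear. -/
  | mon {Ψ q m x ys zs P A As Ds} : m ≠ .L → ys.Nodup → (m = .S → x ∉ ys) →
      ys.length = As.length → zs.map Prod.snd = Ds.map Prod.fst →
      ProcTyp Sg Ψ (SCtx.ofList ys As) (LCtx.ofList (zs.map fun z => va z.1 z.2) Ds) q P (va x m) A →
      ExpTyp Sg Ψ q (.mon m x ys zs P) (.proc m A As Ds)

/-- `Ψ ; Γ ; Δ ⊢^q P :: (x : A)`: the judgment is derived by one of the rules, and it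
obeys the invariants. -/
inductive ProcTyp (Sg : Sig) : FCtx → SCtx → LCtx → ℕ → Proc → Chan → SType → Prop
  | mk {Ψ Γ Δ q P x A} : Inv Sg Γ Δ x A → ProcRule Sg Ψ Γ Δ q P x A → ProcTyp Sg Ψ Γ Δ q P x A

/-- The rules of process typing. -/
inductive ProcRule (Sg : Sig) : FCtx → SCtx → LCtx → ℕ → Proc → Chan → SType → Prop
  /-- Equal types are interchangeable. -/
  | convR {Ψ Γ Δ q P z A B} : ProcTyp Sg Ψ Γ Δ q P z A → SEq Sg A B → ProcRule Sg Ψ Γ Δ q P z B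
  | convL {Ψ Γ Δ q P z C x A B} : ProcTyp Sg Ψ Γ ((x, A) ::ₘ Δ) q P z C → SEq Sg A B →
      ProcRule Sg Ψ Γ ((x, B) ::ₘ Δ) q P z C
  /-- `{}E_{R m}` -/
  | spawnR {Ψ Ψ₁ Ψ₂ Γ Δ' p q x M ds Q z C A Ds} : CtxShare Sg Ψ Ψ₁ Ψ₂ →
      ds.map Chan.mode = Ds.map Prod.fst → (∀ D ∈ Ds, D.1 = .R) →
      ExpTyp Sg Ψ₁ p M (.proc .R A [] Ds) →
      ProcTyp Sg Ψ₂ Γ ((va x .R, A) ::ₘ Δ') q Q z C →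
      ProcRule Sg Ψ Γ (LCtx.ofList ds Ds + Δ') (p + q) (.spawn .R x M [] ds Q) z C
  /-- `{}E_{S m}` -/
  | spawnS {Ψ Ψ₁ Ψ₂ Γ Δ' p q x M as ds Q z C A As Ds} : CtxShare Sg Ψ Ψ₁ Ψ₂ →
      z.mode ≠ .R →
      List.Forall₂ (fun a B => a.mode = .S ∧ ∃ B', Γ a.id = some B' ∧ SEq Sg B' B) as As →
      ds.map Chan.mode = Ds.map Prod.fst → (∀ D ∈ Ds, D.1 = .R) →
      Esync Sg A A →
      ExpTyp Sg Ψ₁ p M (.proc .S A As Ds) →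
      ProcTyp Sg Ψ₂ (Γ.ext x A) Δ' q Q z C →
      ProcRule Sg Ψ Γ (LCtx.ofList ds Ds + Δ') (p + q) (.spawn .S x M as ds Q) z C
  /-- `{}E_{C m}` -/
  | spawnC {Ψ Ψ₁ Ψ₂ Γ Δ' p q x M as ds Q z C A As Ds} : CtxShare Sg Ψ Ψ₁ Ψ₂ →
      z.mode = .L ∨ z.mode = .C →
      List.Forall₂ (fun a B => a.mode = .S ∧ ∃ B', Γ a.id = some B' ∧ SEq Sg B' B) as As →
      ds.map Chan.mode = Ds.map Prod.fst →
      ExpTyp Sg Ψ₁ p M (.proc .C A As Ds) →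
      ProcTyp Sg Ψ₂ Γ ((va x .C, A) ::ₘ Δ') q Q z C →
      ProcRule Sg Ψ Γ (LCtx.ofList ds Ds + Δ') (p + q) (.spawn .C x M as ds Q) z C
  /-- Tail calls, at the mode of the channel that is provided. -/
  | tail {Ψ Γ p x M as ds A As Ds} :
      List.Forall₂ (fun a B => a.mode = .S ∧ ∃ B', Γ a.id = some B' ∧ SEq Sg B' B) as As →
      ds.map Chan.mode = Ds.map Prod.fst →
      ExpTyp Sg Ψ p M (.proc x.mode A As Ds) →
      ProcRule Sg Ψ Γ (LCtx.ofList ds Ds) p (.tail x M as ds) x A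
  /-- `fwd_m`, at a positive or at a negative type -/
  | fwd {Ψ Γ x y A pl} : x.mode = .R ∨ x.mode = .C → y.mode = x.mode →
      (Sg.unfold A).pol = some pl → ProcRule Sg Ψ Γ {(y, A)} 0 (.fwd pl x y) x A
  | plusR {Ψ Γ Δ q P x L A} (k : ℕ) (hk : k ∈ L) : ProcTyp Sg Ψ Γ Δ q P x (A ⟨k, hk⟩) →
      ProcRule Sg Ψ Γ Δ q (.sendLabel x k P) x (.ichoice L A)
  | plusL {Ψ Γ Δ q x L A Q z C} : (∀ l, ProcTyp Sg Ψ Γ ((x, A l) ::ₘ Δ) q (Q l) z C) →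
      ProcRule Sg Ψ Γ ((x, .ichoice L A) ::ₘ Δ) q (.case x L Q) z C
  | withR {Ψ Γ Δ q x L A Q} : (∀ l, ProcTyp Sg Ψ Γ Δ q (Q l) x (A l)) →
      ProcRule Sg Ψ Γ Δ q (.case x L Q) x (.echoice L A)
  | withL {Ψ Γ Δ q P x L A z C} (k : ℕ) (hk : k ∈ L) :
      ProcTyp Sg Ψ Γ ((x, A ⟨k, hk⟩) ::ₘ Δ) q P z C →
      ProcRule Sg Ψ Γ ((x, .echoice L A) ::ₘ Δ) q (.sendLabel x k P) z C
  | tensorR {Ψ Γ Δ q P x w A B} : ProcTyp Sg Ψ Γ Δ q P x B →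
      ProcRule Sg Ψ Γ ((w, A) ::ₘ Δ) q (.sendCh x w P) x (.tensor w.mode A B)
  | tensorL {Ψ Γ Δ q Q x y n A B z C} :
      ProcTyp Sg Ψ Γ ((va y n, A) ::ₘ (x, B) ::ₘ Δ) q Q z C →
      ProcRule Sg Ψ Γ ((x, .tensor n A B) ::ₘ Δ) q (.recvCh x y n Q) z C
  | lolliR {Ψ Γ Δ q P x y n A B} : ProcTyp Sg Ψ Γ ((va y n, A) ::ₘ Δ) q P x B →
      ProcRule Sg Ψ Γ Δ q (.recvCh x y n P) x (.lolli n A B)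
  | lolliL {Ψ Γ Δ q Q x w A B z C} : ProcTyp Sg Ψ Γ ((x, B) ::ₘ Δ) q Q z C →
      ProcRule Sg Ψ Γ ((w, A) ::ₘ (x, .lolli w.mode A B) ::ₘ Δ) q (.sendCh x w Q) z C
  | timesR {Ψ Ψ₁ Ψ₂ Γ Δ p q M P x τ A} : CtxShare Sg Ψ Ψ₁ Ψ₂ → ExpTyp Sg Ψ₁ p M τ →
      ProcTyp Sg Ψ₂ Γ Δ q P x A → ProcRule Sg Ψ Γ Δ (p + q) (.sendVal x M P) x (.vtimes τ A)
  | timesL {Ψ Γ Δ q Q x y τ A z C} : ProcTyp Sg (Ψ.ext y τ) Γ ((x, A) ::ₘ Δ) q Q z C →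
      ProcRule Sg Ψ Γ ((x, .vtimes τ A) ::ₘ Δ) q (.recvVal x y Q) z C
  | arrowR {Ψ Γ Δ q P x y τ A} : ProcTyp Sg (Ψ.ext y τ) Γ Δ q P x A →
      ProcRule Sg Ψ Γ Δ q (.recvVal x y P) x (.varrow τ A)
  | arrowL {Ψ Ψ₁ Ψ₂ Γ Δ p q M Q x τ A z C} : CtxShare Sg Ψ Ψ₁ Ψ₂ → ExpTyp Sg Ψ₁ p M τ →
      ProcTyp Sg Ψ₂ Γ ((x, A) ::ₘ Δ) q Q z C →
      ProcRule Sg Ψ Γ ((x, .varrow τ A) ::ₘ Δ) (p + q) (.sendVal x M Q) z C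
  | oneR {Ψ Γ x} : ProcRule Sg Ψ Γ 0 0 (.close x) x .one
  | oneL {Ψ Γ Δ q Q x z C} : ProcTyp Sg Ψ Γ Δ q Q z C →
      ProcRule Sg Ψ Γ ((x, .one) ::ₘ Δ) q (.wait x Q) z C
  | work {Ψ Γ Δ p r P x A} : ProcTyp Sg Ψ Γ Δ p P x A → ProcRule Sg Ψ Γ Δ (p + r) (.work r P) x A
  | payR {Ψ Γ Δ p r P x A} : ProcTyp Sg Ψ Γ Δ p P x A →
      ProcRule Sg Ψ Γ Δ (p + r) (.pay x r P) x (.paypot r A)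
  | payL {Ψ Γ Δ q r P x A z C} : ProcTyp Sg Ψ Γ ((x, A) ::ₘ Δ) (q + r) P z C →
      ProcRule Sg Ψ Γ ((x, .paypot r A) ::ₘ Δ) q (.get x r P) z C
  | getR {Ψ Γ Δ q r P x A} : ProcTyp Sg Ψ Γ Δ (q + r) P x A →
      ProcRule Sg Ψ Γ Δ q (.get x r P) x (.getpot r A)
  | getL {Ψ Γ Δ p r P x A z C} : ProcTyp Sg Ψ Γ ((x, A) ::ₘ Δ) p P z C →
      ProcRule Sg Ψ Γ ((x, .getpot r A) ::ₘ Δ) (p + r) (.pay x r P) z C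
  /-- `↑R`, `↑L`, `↓R`, `↓L` -/
  | upR {Ψ Γ Δ q P i y A} : PureLin Δ → ProcTyp Sg Ψ Γ Δ q P (va y .L) A →
      ProcRule Sg Ψ Γ Δ q (.accept y ⟨i, .S⟩ P) ⟨i, .S⟩ (.up A)
  | upL {Ψ Γ Δ q Q i y A B z C} : z.mode = .L ∨ z.mode = .C →
      Γ i = some B → SEq Sg B (.up A) →
      ProcTyp Sg Ψ Γ ((va y .L, A) ::ₘ Δ) q Q z C →
      ProcRule Sg Ψ Γ Δ q (.acquire y ⟨i, .S⟩ Q) z C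
  | downR {Ψ Γ Δ q P i y A} : PureLin Δ → ProcTyp Sg Ψ Γ Δ q P (va y .S) A →
      ProcRule Sg Ψ Γ Δ q (.detach y ⟨i, .L⟩ P) ⟨i, .L⟩ (.down A)
  | downL {Ψ Γ Δ q Q i y A z C} : z.mode = .L ∨ z.mode = .C →
      ProcTyp Sg Ψ (Γ.ext y A) Δ q Q z C →
      ProcRule Sg Ψ Γ ((⟨i, .L⟩, .down A) ::ₘ Δ) q (.release y ⟨i, .L⟩ Q) z C
end

/-- A well-formed signature: type definitions are contractive and function definitions are
well-typed. -/
structure Sig.WellFormed (Sg : Sig) : Prop where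
  stype : ∀ V A, Sg.stype V = some A → ∀ W, A ≠ .name W
  ftype : ∀ t τ, Sg.ftype t = some τ → ∀ s, τ ≠ .name s
  fn : ∀ f M τ p, Sg.fn f = some (M, τ, p) → ExpTyp Sg FCtx.empty p M τ

/-- Rules for typing messages, `· ; · ; Δ ⊢^q M :: (c : A)`.  A message is typed as the process
that it stands for: each rule is the rule for the corresponding send, followed by the identity
rule for the forwarding at the continuation type. -/
inductive MsgRule (Sg : Sig) : LCtx → ℕ → Msg → Chan → SType → Prop
  | convR {Δ q M c A B} : MsgRule Sg Δ q M c A → SEq Sg A B → MsgRule Sg Δ q M c B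
  | convL {Δ q M c C x A B} : MsgRule Sg ((x, A) ::ₘ Δ) q M c C → SEq Sg A B →
      MsgRule Sg ((x, B) ::ₘ Δ) q M c C
  | plus {c c' L A} (k : ℕ) (hk : k ∈ L) : c'.mode = c.mode →
      MsgRule Sg {(c', A ⟨k, hk⟩)} 0 (.out (.label k) c') c (.ichoice L A)
  | with {c e L A} (k : ℕ) (hk : k ∈ L) : e.mode = c.mode →
      MsgRule Sg {(e, .echoice L A)} 0 (.inn (.label k) e) c (A ⟨k, hk⟩)
  | tensor {c c' w A B} : c'.mode = c.mode →
      MsgRule Sg {(w, A), (c', B)} 0 (.out (.chan w) c') c (.tensor w.mode A B)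
  | lolli {c e w A B} : e.mode = c.mode →
      MsgRule Sg {(w, A), (e, .lolli w.mode A B)} 0 (.inn (.chan w) e) c B
  | times {c c' p N τ A} : c'.mode = c.mode → ExpTyp Sg FCtx.empty p N τ →
      MsgRule Sg {(c', A)} p (.out (.val N) c') c (.vtimes τ A)
  | arrow {c e p N τ A} : e.mode = c.mode → ExpTyp Sg FCtx.empty p N τ →
      MsgRule Sg {(e, .varrow τ A)} p (.inn (.val N) e) c A
  | one {c} : MsgRule Sg 0 0 .close c .one
  | pay {c c' r A} : c'.mode = c.mode → MsgRule Sg {(c', A)} r (.out (.pot r) c') c (.paypot r A)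
  | get {c e r A} : e.mode = c.mode → MsgRule Sg {(e, .getpot r A)} r (.inn (.pot r) e) c A

/-! ## Typing of configurations -/

/-- `Γ₀` as a shared context. -/
def SCtx.ofGlobal (Γ₀ : ℕ → Option SType) : SCtx
  | .name a 0 => Γ₀ a
  | _ => none

/-- `Γ₀ ⊨^E Ω :: (Γ ; Δ)`.  `Γ₀` gives the types of the shared channels `a_S`, `Γ` lists the
shared channels `a_S` that are provided by processes of `Ω`, be it in shared or in linear mode. -/
inductive CfgTyp (Sg : Sig) (Γ₀ : ℕ → Option SType) :
    ℕ → Cfg → Multiset (ℕ × SType) → LCtx → Prop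
  | emp : CfgTyp Sg Γ₀ 0 0 0 0
  | procR {E q w Ω Γ Δ Δ' a k P A} : CfgTyp Sg Γ₀ E Ω Γ (Δ + Δ') →
      ProcTyp Sg FCtx.empty SCtx.empty Δ' q P (ch a k .R) A →
      CfgTyp Sg Γ₀ (E + q + w) (.proc (ch a k .R) w P ::ₘ Ω) Γ ((ch a k .R, A) ::ₘ Δ)
  | procS {E q w Ω Γ Δ Δ' a P A} : Γ₀ a = some A → Esync Sg A A →
      CfgTyp Sg Γ₀ E Ω Γ (Δ + Δ') →
      ProcTyp Sg FCtx.empty (SCtx.ofGlobal Γ₀) Δ' q P (sh a) A →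
      CfgTyp Sg Γ₀ (E + q + w) (.proc (sh a) w P ::ₘ Ω) ((a, A) ::ₘ Γ) Δ
  | procL {E q w Ω Γ Δ Δ' a k P A B} : Γ₀ a = some B → Esync Sg A B →
      CfgTyp Sg Γ₀ E Ω Γ (Δ + Δ') →
      ProcTyp Sg FCtx.empty (SCtx.ofGlobal Γ₀) Δ' q P (ch a k .L) A →
      CfgTyp Sg Γ₀ (E + q + w) (.proc (ch a k .L) w P ::ₘ Ω) ((a, B) ::ₘ Γ) ((ch a k .L, A) ::ₘ Δ)
  | procC {E q w Ω Γ Δ Δ' a k P A} : CfgTyp Sg Γ₀ E Ω Γ (Δ + Δ') →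
      ProcTyp Sg FCtx.empty (SCtx.ofGlobal Γ₀) Δ' q P (ch a k .C) A →
      CfgTyp Sg Γ₀ (E + q + w) (.proc (ch a k .C) w P ::ₘ Ω) Γ ((ch a k .C, A) ::ₘ Δ)
  | msg {E q w Ω Γ Δ Δ' a k m M A} : CfgTyp Sg Γ₀ E Ω Γ (Δ + Δ') →
      Inv Sg SCtx.empty Δ' (ch a k m) A → MsgRule Sg Δ' q M (ch a k m) A →
      CfgTyp Sg Γ₀ (E + q + w) (.msg (ch a k m) w M ::ₘ Ω) Γ ((ch a k m, A) ::ₘ Δ)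

/-- Well-formed configurations: the channels in `Γ` and in `Δ` are unique (those in `Γ₀` are, since
`Γ₀` is a partial map), no two objects provide the same channel, and `Γ ⊆ Γ₀`. -/
structure WellFormed (Γ₀ : ℕ → Option SType) (Ω : Cfg) (Γ : Multiset (ℕ × SType)) (Δ : LCtx) :
    Prop where
  shared : (Γ.map Prod.fst).Nodup
  linear : (Δ.map Prod.fst).Nodup
  provides : (Ω.map Obj.provides).Nodup
  subset : ∀ p ∈ Γ, Γ₀ p.1 = some p.2

/-- Closed configurations: every shared channel that the processes may refer to is provided in the
configuration.  (That linear channels are, is part of configuration typing.) -/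
def Closed (Γ₀ : ℕ → Option SType) (Γ : Multiset (ℕ × SType)) : Prop :=
  ∀ a A, Γ₀ a = some A → (a, A) ∈ Γ

/-! ## Dynamics of expressions -/

/-- Values. -/
inductive Val : Exp → Prop
  | lam (x τ M) : Val (.lam x τ M)
  | inl {V} : Val V → Val (.inl V)
  | inr {V} : Val V → Val (.inr V)
  | pair {V W} : Val V → Val W → Val (.pair V W)
  | int (n) : Val (.int n)
  | bool (b) : Val (.bool b)
  | nil : Val .nil
  | cons {V W} : Val V → Val W → Val (.cons V W)
  | mon (m x ys zs P) : Val (.mon m x ys zs P)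

/-- `EStep Sg M μ M'`: one step of call-by-value evaluation from `M` to `M'`, with cost `μ`. -/
inductive EStep (Sg : Sig) : Exp → ℕ → Exp → Prop
  | fn {f M τ p} : Sg.fn f = some (M, τ, p) → EStep Sg (.fn f) 0 M
  | appL {M M' N μ} : EStep Sg M μ M' → EStep Sg (.app M N) μ (.app M' N)
  | appR {V N N' μ} : Val V → EStep Sg N μ N' → EStep Sg (.app V N) μ (.app V N')
  | beta {x τ M V} : Val V → EStep Sg (.app (.lam x τ M) V) 0 (M.substV x V)
  | inl {M M' μ} : EStep Sg M μ M' → EStep Sg (.inl M) μ (.inl M')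
  | inr {M M' μ} : EStep Sg M μ M' → EStep Sg (.inr M) μ (.inr M')
  | case {M M' μ x Ml y Mr} : EStep Sg M μ M' →
      EStep Sg (.case M x Ml y Mr) μ (.case M' x Ml y Mr)
  | caseInl {V x Ml y Mr} : Val V → EStep Sg (.case (.inl V) x Ml y Mr) 0 (Ml.substV x V)
  | caseInr {V x Ml y Mr} : Val V → EStep Sg (.case (.inr V) x Ml y Mr) 0 (Mr.substV y V)
  | pairL {M M' N μ} : EStep Sg M μ M' → EStep Sg (.pair M N) μ (.pair M' N)
  | pairR {V N N' μ} : Val V → EStep Sg N μ N' → EStep Sg (.pair V N) μ (.pair V N')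
  | fst {M M' μ} : EStep Sg M μ M' → EStep Sg (.fst M) μ (.fst M')
  | snd {M M' μ} : EStep Sg M μ M' → EStep Sg (.snd M) μ (.snd M')
  | fstPair {V W} : Val V → Val W → EStep Sg (.fst (.pair V W)) 0 V
  | sndPair {V W} : Val V → Val W → EStep Sg (.snd (.pair V W)) 0 W
  | ite {M M' Mt Mf μ} : EStep Sg M μ M' → EStep Sg (.ite M Mt Mf) μ (.ite M' Mt Mf)
  | iteTrue {Mt Mf} : EStep Sg (.ite (.bool true) Mt Mf) 0 Mt
  | iteFalse {Mt Mf} : EStep Sg (.ite (.bool false) Mt Mf) 0 Mf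
  | arithL {o M M' N μ} : EStep Sg M μ M' → EStep Sg (.arith o M N) μ (.arith o M' N)
  | arithR {o V N N' μ} : Val V → EStep Sg N μ N' → EStep Sg (.arith o V N) μ (.arith o V N')
  | arith {o i j} : EStep Sg (.arith o (.int i) (.int j)) 0 (.int (o i j))
  | compL {o M M' N μ} : EStep Sg M μ M' → EStep Sg (.comp o M N) μ (.comp o M' N)
  | compR {o V N N' μ} : Val V → EStep Sg N μ N' → EStep Sg (.comp o V N) μ (.comp o V N')
  | comp {o i j} : EStep Sg (.comp o (.int i) (.int j)) 0 (.bool (o i j))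
  | consL {M M' N μ} : EStep Sg M μ M' → EStep Sg (.cons M N) μ (.cons M' N)
  | consR {V N N' μ} : Val V → EStep Sg N μ N' → EStep Sg (.cons V N) μ (.cons V N')
  | lmatch {M M' M₁ x xs M₂ μ} : EStep Sg M μ M' →
      EStep Sg (.lmatch M M₁ x xs M₂) μ (.lmatch M' M₁ x xs M₂)
  | matchNil {M₁ x xs M₂} : EStep Sg (.lmatch .nil M₁ x xs M₂) 0 M₁
  | matchCons {V W M₁ x xs M₂} : Val V → Val W →
      EStep Sg (.lmatch (.cons V W) M₁ x xs M₂) 0 ((M₂.substV x V).substV xs W)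
  | tick {r M} : EStep Sg (.tick r M) r M

/-! ## Dynamics of configurations -/

/-- `Ω ↦ Ω'`: multiset rewriting; `Θ` is the part of the configuration that a rule leaves alone.
In the rules for sending, the continuation channel `c⁺` of `c = ch a k m` is a fresh
`ch a k' m`. -/
inductive Step (Sg : Sig) : Cfg → Cfg → Prop
  /-- Evaluation of the expression in `P[N]`, where `P[·]` is a spawn, a tail call or the
  sending of a value. -/
  | internalSpawn {Θ c w m x N N' μ as ds Q} : EStep Sg N μ N' →
      Step Sg (.proc c w (.spawn m x N as ds Q) ::ₘ Θ)
        (.proc c (w + μ) (.spawn m x N' as ds Q) ::ₘ Θ)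
  | internalTail {Θ c w x N N' μ as ds} : EStep Sg N μ N' →
      Step Sg (.proc c w (.tail x N as ds) ::ₘ Θ) (.proc c (w + μ) (.tail x N' as ds) ::ₘ Θ)
  | internalSend {Θ c w x N N' μ P} : EStep Sg N μ N' →
      Step Sg (.proc c w (.sendVal x N P) ::ₘ Θ) (.proc c (w + μ) (.sendVal x N' P) ::ₘ Θ)
  /-- `{}E_{R m}`, `{}E_{S m}` and `{}E_{C m}` -/
  | spawn {Θ d w m x x' ys zs P as ds Q} (c : ℕ) :
      FreshBase c (.proc d w (.spawn m x (.mon m x' ys zs P) as ds Q) ::ₘ Θ) →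
      ys.length = as.length → zs.map Prod.snd = ds.map Chan.mode →
      Step Sg (.proc d w (.spawn m x (.mon m x' ys zs P) as ds Q) ::ₘ Θ)
        (.proc (ch c 0 m) 0 (P.substAll ((va x' m, ch c 0 m) ::
            ((ys.map fun y => va y .S).zip as ++ (zs.map fun z => va z.1 z.2).zip ds))) ::ₘ
          .proc d w (Q.substC (va x m) (ch c 0 m)) ::ₘ Θ)
  | tail {Θ c w x' ys zs P as ds} :
      ys.length = as.length → zs.map Prod.snd = ds.map Chan.mode →
      Step Sg (.proc c w (.tail c (.mon c.mode x' ys zs P) as ds) ::ₘ Θ)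
        (.proc c w (P.substAll ((va x' c.mode, c) ::
            ((ys.map fun y => va y .S).zip as ++ (zs.map fun z => va z.1 z.2).zip ds))) ::ₘ Θ)
  | fwdPos {Θ c d w w' M} : c.mode = d.mode →
      Step Sg (.msg d w' M ::ₘ .proc c w (.fwd .pos c d) ::ₘ Θ)
        (.msg c (w + w') (M.subst d c) ::ₘ Θ)
  | fwdNeg {Θ c d e w w' M} : c.mode = d.mode → c ∈ M.used →
      Step Sg (.proc c w (.fwd .neg c d) ::ₘ .msg e w' M ::ₘ Θ)
        (.msg e (w + w') (M.subst c d) ::ₘ Θ)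
  | plusS {Θ a k m w l P} (k' : ℕ) :
      Fresh (ch a k' m) (.proc (ch a k m) w (.sendLabel (ch a k m) l P) ::ₘ Θ) →
      Step Sg (.proc (ch a k m) w (.sendLabel (ch a k m) l P) ::ₘ Θ)
        (.proc (ch a k' m) w (P.substC (ch a k m) (ch a k' m)) ::ₘ
          .msg (ch a k m) 0 (.out (.label l) (ch a k' m)) ::ₘ Θ)
  | plusC {Θ c c' d w w' l L Q} (hl : l ∈ L) :
      Step Sg (.msg c w (.out (.label l) c') ::ₘ .proc d w' (.case c L Q) ::ₘ Θ)
        (.proc d (w + w') ((Q ⟨l, hl⟩).substC c c') ::ₘ Θ)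
  | withS {Θ d a k m w l P} (k' : ℕ) : d ≠ ch a k m →
      Fresh (ch a k' m) (.proc d w (.sendLabel (ch a k m) l P) ::ₘ Θ) →
      Step Sg (.proc d w (.sendLabel (ch a k m) l P) ::ₘ Θ)
        (.msg (ch a k' m) 0 (.inn (.label l) (ch a k m)) ::ₘ
          .proc d w (P.substC (ch a k m) (ch a k' m)) ::ₘ Θ)
  | withC {Θ c c' w w' l L Q} (hl : l ∈ L) :
      Step Sg (.proc c w' (.case c L Q) ::ₘ .msg c' w (.inn (.label l) c) ::ₘ Θ)
        (.proc c' (w + w') ((Q ⟨l, hl⟩).substC c c') ::ₘ Θ)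
  | tensorS {Θ a k m w e P} (k' : ℕ) :
      Fresh (ch a k' m) (.proc (ch a k m) w (.sendCh (ch a k m) e P) ::ₘ Θ) →
      Step Sg (.proc (ch a k m) w (.sendCh (ch a k m) e P) ::ₘ Θ)
        (.proc (ch a k' m) w (P.substC (ch a k m) (ch a k' m)) ::ₘ
          .msg (ch a k m) 0 (.out (.chan e) (ch a k' m)) ::ₘ Θ)
  | tensorC {Θ c c' d w w' e x Q} :
      Step Sg (.msg c w (.out (.chan e) c') ::ₘ .proc d w' (.recvCh c x e.mode Q) ::ₘ Θ)
        (.proc d (w + w') ((Q.substC (va x e.mode) e).substC c c') ::ₘ Θ)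
  | lolliS {Θ d a k m w e P} (k' : ℕ) : d ≠ ch a k m →
      Fresh (ch a k' m) (.proc d w (.sendCh (ch a k m) e P) ::ₘ Θ) →
      Step Sg (.proc d w (.sendCh (ch a k m) e P) ::ₘ Θ)
        (.msg (ch a k' m) 0 (.inn (.chan e) (ch a k m)) ::ₘ
          .proc d w (P.substC (ch a k m) (ch a k' m)) ::ₘ Θ)
  | lolliC {Θ c c' w w' e x Q} :
      Step Sg (.proc c w' (.recvCh c x e.mode Q) ::ₘ .msg c' w (.inn (.chan e) c) ::ₘ Θ)
        (.proc c' (w + w') ((Q.substC (va x e.mode) e).substC c c') ::ₘ Θ)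
  | timesS {Θ a k m w N P} (k' : ℕ) : Val N →
      Fresh (ch a k' m) (.proc (ch a k m) w (.sendVal (ch a k m) N P) ::ₘ Θ) →
      Step Sg (.proc (ch a k m) w (.sendVal (ch a k m) N P) ::ₘ Θ)
        (.proc (ch a k' m) w (P.substC (ch a k m) (ch a k' m)) ::ₘ
          .msg (ch a k m) 0 (.out (.val N) (ch a k' m)) ::ₘ Θ)
  | timesC {Θ c c' d w w' N x Q} :
      Step Sg (.msg c w (.out (.val N) c') ::ₘ .proc d w' (.recvVal c x Q) ::ₘ Θ)
        (.proc d (w + w') ((Q.substV x N).substC c c') ::ₘ Θ)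
  | arrowS {Θ d a k m w N P} (k' : ℕ) : Val N → d ≠ ch a k m →
      Fresh (ch a k' m) (.proc d w (.sendVal (ch a k m) N P) ::ₘ Θ) →
      Step Sg (.proc d w (.sendVal (ch a k m) N P) ::ₘ Θ)
        (.msg (ch a k' m) 0 (.inn (.val N) (ch a k m)) ::ₘ
          .proc d w (P.substC (ch a k m) (ch a k' m)) ::ₘ Θ)
  | arrowC {Θ c c' w w' N x Q} :
      Step Sg (.proc c w' (.recvVal c x Q) ::ₘ .msg c' w (.inn (.val N) c) ::ₘ Θ)
        (.proc c' (w + w') ((Q.substV x N).substC c c') ::ₘ Θ)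
  | oneS {Θ c w} : Step Sg (.proc c w (.close c) ::ₘ Θ) (.msg c w .close ::ₘ Θ)
  | oneC {Θ c d w w' Q} :
      Step Sg (.msg c w .close ::ₘ .proc d w' (.wait c Q) ::ₘ Θ) (.proc d (w + w') Q ::ₘ Θ)
  | work {Θ c w μ P} : Step Sg (.proc c w (.work μ P) ::ₘ Θ) (.proc c (w + μ) P ::ₘ Θ)
  | payS {Θ a k m w r P} (k' : ℕ) :
      Fresh (ch a k' m) (.proc (ch a k m) w (.pay (ch a k m) r P) ::ₘ Θ) →
      Step Sg (.proc (ch a k m) w (.pay (ch a k m) r P) ::ₘ Θ)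
        (.proc (ch a k' m) w (P.substC (ch a k m) (ch a k' m)) ::ₘ
          .msg (ch a k m) 0 (.out (.pot r) (ch a k' m)) ::ₘ Θ)
  | payC {Θ c c' d w w' r Q} :
      Step Sg (.msg c w (.out (.pot r) c') ::ₘ .proc d w' (.get c r Q) ::ₘ Θ)
        (.proc d (w + w') (Q.substC c c') ::ₘ Θ)
  | getS {Θ d a k m w r P} (k' : ℕ) : d ≠ ch a k m →
      Fresh (ch a k' m) (.proc d w (.pay (ch a k m) r P) ::ₘ Θ) →
      Step Sg (.proc d w (.pay (ch a k m) r P) ::ₘ Θ)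
        (.msg (ch a k' m) 0 (.inn (.pot r) (ch a k m)) ::ₘ
          .proc d w (P.substC (ch a k m) (ch a k' m)) ::ₘ Θ)
  | getC {Θ c c' w w' r Q} :
      Step Sg (.proc c w' (.get c r Q) ::ₘ .msg c' w (.inn (.pot r) c) ::ₘ Θ)
        (.proc c' (w + w') (Q.substC c c') ::ₘ Θ)
  | upC {Θ a c w w' x y P Q} (k : ℕ) :
      Fresh (ch a k .L) (.proc (sh a) w' (.accept x (sh a) P) ::ₘ
        .proc c w (.acquire y (sh a) Q) ::ₘ Θ) →
      Step Sg (.proc (sh a) w' (.accept x (sh a) P) ::ₘ .proc c w (.acquire y (sh a) Q) ::ₘ Θ)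
        (.proc (ch a k .L) w' (P.substC (va x .L) (ch a k .L)) ::ₘ
          .proc c w (Q.substC (va y .L) (ch a k .L)) ::ₘ Θ)
  | downC {Θ a k c w w' x y P Q} :
      Step Sg (.proc (ch a k .L) w' (.detach x (ch a k .L) P) ::ₘ
          .proc c w (.release y (ch a k .L) Q) ::ₘ Θ)
        (.proc (sh a) w' (P.substC (va x .S) (sh a)) ::ₘ
          .proc c w (Q.substC (va y .S) (sh a)) ::ₘ Θ)

/-! ## Poised and blocked -/

/-- Poised objects: processes that wait to receive along the channel that they provide, and
messages that are sent along the channel that they provide. -/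
inductive Poised : Obj → Prop
  | fwd (c w d) : Poised (.proc c w (.fwd .neg c d))
  | case (c w L Q) : Poised (.proc c w (.case c L Q))
  | recvCh (c w x n P) : Poised (.proc c w (.recvCh c x n P))
  | recvVal (c w x P) : Poised (.proc c w (.recvVal c x P))
  | accept (a w y P) : Poised (.proc (sh a) w (.accept y (sh a) P))
  | detach (a k w y P) : Poised (.proc (ch a k .L) w (.detach y (ch a k .L) P))
  | get (c w r P) : Poised (.proc c w (.get c r P))
  | out (c w pl c') : Poised (.msg c w (.out pl c'))
  | close (c w) : Poised (.msg c w .close)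

/-- In `Ω`, the process that provides `c` is trying to acquire the shared channel `a_S`. -/
def Acquiring (Ω : Cfg) (c : Chan) (a : ℕ) : Prop :=
  ∃ w y Q, Obj.proc c w (.acquire y (sh a) Q) ∈ Ω

end Nomos

namespace Nomos

/-! ## Head constructors of types -/

-- Suppose that a configuration cannot move and that no process is trying to acquire a contract held
-- in linear mode. Linear channels alone cannot cause a deadlock. Configuration typing adds objects
-- one at a time, and each uses only linear channels offered by those already present, so linear
-- dependency is well-founded (`CfgTyp.forest`). Along this order, an object that uses only channels
-- of poised providers is itself poised or enables a step (`ObjInv.poised`). The head constructor of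
-- a type determines what a poised provider looks like (`Poised.form`), and this is the partner that
-- a receiving client waits for. Sending is asynchronous and needs only a fresh continuation
-- channel, and a closed expression is a value or evaluates further (`ExpTyp.progress`).
--
-- The one action that waits for a shared channel is acquiring, and the order says nothing about
-- shared channels: the provider of `a_S` may be above or below the process that acquires it. So the
-- induction `Forest.poised` is run twice. The first run covers the modes `R` and `S`: such objects
-- use only purely linear channels and may not acquire, hence all of them are poised, and a poised
-- process providing `a_S` accepts. The second run covers all modes: by closedness, an acquired
-- `a_S` has a provider, either in shared mode, where it accepts and the two processes can
-- synchronize, or in linear mode. Both are excluded, so nothing acquires and every object is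
-- poised.
--
-- Types matter only up to equi-recursive equality, and a conversion may occur anywhere in a
-- derivation. Inversion is therefore phrased by the head constructor after unfolding, which
-- conversions preserve (`ProcTyp.head`, `MsgRule.head`). Progress looks one action ahead, so
-- continuation types can be forgotten.

/-- The head constructor of a session type, with the data that determine how it is used. -/
inductive Shape
  | name (V : ℕ)
  | ichoice (L : Finset ℕ)
  | echoice (L : Finset ℕ)
  | tensor (n : Mode)
  | lolli (n : Mode)
  | one
  | varrow
  | vtimes
  | paypot (r : ℕ)
  | getpot (r : ℕ)
  | up
  | down

def SType.shape : SType → Shape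
  | .name V => .name V
  | .ichoice L _ => .ichoice L
  | .echoice L _ => .echoice L
  | .tensor n _ _ => .tensor n
  | .lolli n _ _ => .lolli n
  | .one => .one
  | .varrow _ _ => .varrow
  | .vtimes _ _ => .vtimes
  | .paypot r _ => .paypot r
  | .getpot r _ => .getpot r
  | .up _ => .up
  | .down _ => .down

def Shape.pol : Shape → Option Pol
  | .ichoice _ => some .pos
  | .tensor _ => some .pos
  | .one => some .pos
  | .vtimes => some .pos
  | .paypot _ => some .pos
  | .echoice _ => some .neg
  | .lolli _ => some .neg
  | .varrow => some .neg
  | .getpot _ => some .neg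
  | .up => none
  | .down => none
  | .name _ => none

theorem SType.pol_shape (A : SType) : A.shape.pol = A.pol := by
  cases A <;> rfl

/-- The shape of a type after unfolding. -/
def Sig.shape (Sg : Sig) (A : SType) : Shape := (Sg.unfold A).shape

/-- A bisimulation relates only types whose unfoldings have the same head, and label sets, modes of
transmitted channels and amounts of potential belong to the head. -/
theorem SEq.shape_eq {Sg : Sig} {A B : SType} (h : SEq Sg A B) : Sg.shape A = Sg.shape B := by
  obtain ⟨RF, RS, hb, hr⟩ := h
  have := hb.stype A B hr
  unfold Sig.shape
  revert this
  generalize Sg.unfold A = A'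
  generalize Sg.unfold B = B'
  intro this
  cases this <;> rfl

/-- In the grammar, every production but two requires a mode other than `S`. Of these two, `down`
lives at mode `L`, which leaves `up`; a type name that does not unfold has no production. -/
theorem InLang.shape_eq_up {Sg : Sig} {A : SType} (h : InLang Sg .S A) : Sg.shape A = .up := by
  obtain ⟨X, hX, hc⟩ := h
  have := hc _ _ hX
  unfold Sig.shape
  revert this
  generalize Sg.unfold A = A'
  intro this
  cases this <;> first | rfl | contradiction

/-- The head constructor of a functional type. -/
inductive FShape
  | name (t : ℕ)
  | int
  | bool
  | arr
  | sum
  | prod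
  | list (q : ℕ)
  | proc (m : Mode) (n : ℕ) (ms : List Mode)

/-- For monadic types, the number of shared arguments and the modes of the linear ones are kept:
these are what the side conditions of spawning and of tail calls compare. -/
def FType.shape : FType → FShape
  | .name t => .name t
  | .int => .int
  | .bool => .bool
  | .arr _ _ => .arr
  | .sum _ _ => .sum
  | .prod _ _ => .prod
  | .list q _ => .list q
  | .proc m _ As Ds => .proc m As.length (Ds.map Prod.fst)

theorem FEq.shape_eq {Sg : Sig} {σ τ : FType} (h : FEq Sg σ τ) :
    (Sg.unfoldF σ).shape = (Sg.unfoldF τ).shape := by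
  obtain ⟨RF, RS, hb, hr⟩ := h
  have := hb.ftype σ τ hr
  revert this
  generalize Sg.unfoldF σ = σ'
  generalize Sg.unfoldF τ = τ'
  intro this
  cases this with
  | @proc m A A' As As' Ds Ds' _ h₁ h₂ =>
    have : Ds.map Prod.fst = Ds'.map Prod.fst := by
      induction h₂ with
      | nil => rfl
      | cons h _ ih => simp [h.1, ih]
    simp [FType.shape, h₁.length_eq, this]
  | _ => rfl

/-! ## Progress of expressions -/

/-- The form of the values of a type. -/
def Canonical (M : Exp) : FShape → Prop
  | .name _ => False
  | .int => ∃ n, M = .int n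
  | .bool => ∃ b, M = .bool b
  | .arr => ∃ x τ N, M = .lam x τ N
  | .sum => ∃ V, M = .inl V ∨ M = .inr V
  | .prod => ∃ V W, M = .pair V W
  | .list _ => M = .nil ∨ ∃ V W, M = .cons V W
  | .proc m n ms => ∃ x ys zs P, M = .mon m x ys zs P ∧ ys.length = n ∧ zs.map Prod.snd = ms

/-- `M` is a value of the given shape, or can be evaluated further. -/
def ExpProgress (Sg : Sig) (M : Exp) (s : FShape) : Prop :=
  (Val M ∧ Canonical M s) ∨ ∃ μ M', EStep Sg M μ M'

/-- Keeps inductions on typing derivations among closed terms: sharing cannot create variables. -/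
theorem CtxShare.eq_empty {Sg : Sig} {Ψ₁ Ψ₂ : FCtx} (h : CtxShare Sg FCtx.empty Ψ₁ Ψ₂) :
    Ψ₁ = FCtx.empty ∧ Ψ₂ = FCtx.empty := by
  constructor <;> funext x <;> rcases h x with h | h | h | ⟨_, _, _, h, _⟩ <;>
    simp_all [FCtx.empty]

/-- Progress and canonical forms are proved together by induction on the derivation. Speaking of the
unfolded shape makes the conversion rule harmless, and the canonical form of the principal
subexpression is what each elimination form needs in order to reduce. -/
theorem ExpTyp.progress {Sg : Sig} {Ψ : FCtx} {q : ℕ} {M : Exp} {τ : FType}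
    (h : ExpTyp Sg Ψ q M τ) (hΨ : Ψ = FCtx.empty) :
    ExpProgress Sg M (Sg.unfoldF τ).shape := by
  -- The motives for processes are trivial: a monadic expression is already a value, whatever its
  -- body does.
  induction h using ExpTyp.rec (motive_2 := fun _ _ _ _ _ _ _ _ => True)
    (motive_3 := fun _ _ _ _ _ _ _ _ => True) with
  | conv _ he ih => rw [← he.shape_eq]; exact ih hΨ
  | relax _ _ ih => exact ih hΨ
  | var h => subst hΨ; simp [FCtx.empty] at h
  | fn h => exact .inr ⟨_, _, .fn h⟩
  | lam => exact .inl ⟨.lam _ _ _, _, _, _, rfl⟩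
  | app hs _ _ ih₁ ih₂ =>
    subst hΨ
    obtain ⟨rfl, rfl⟩ := hs.eq_empty
    rcases ih₁ rfl with ⟨hv, x, τ, N, rfl⟩ | ⟨_, _, h⟩
    · rcases ih₂ rfl with ⟨hw, -⟩ | ⟨_, _, h⟩
      · exact .inr ⟨_, _, .beta hw⟩
      · exact .inr ⟨_, _, .appR hv h⟩
    · exact .inr ⟨_, _, .appL h⟩
  | inl _ ih =>
    rcases ih hΨ with ⟨hv, -⟩ | ⟨_, _, h⟩
    · exact .inl ⟨.inl hv, _, .inl rfl⟩
    · exact .inr ⟨_, _, .inl h⟩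
  | inr _ ih =>
    rcases ih hΨ with ⟨hv, -⟩ | ⟨_, _, h⟩
    · exact .inl ⟨.inr hv, _, .inr rfl⟩
    · exact .inr ⟨_, _, .inr h⟩
  | case hs _ _ _ ih =>
    subst hΨ
    obtain ⟨rfl, rfl⟩ := hs.eq_empty
    rcases ih rfl with ⟨hv, V, rfl | rfl⟩ | ⟨_, _, h⟩
    · cases hv with | inl hv => exact .inr ⟨_, _, .caseInl hv⟩
    · cases hv with | inr hv => exact .inr ⟨_, _, .caseInr hv⟩
    · exact .inr ⟨_, _, .case h⟩
  | pair hs _ _ ih₁ ih₂ =>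
    subst hΨ
    obtain ⟨rfl, rfl⟩ := hs.eq_empty
    rcases ih₁ rfl with ⟨hv, -⟩ | ⟨_, _, h⟩
    · rcases ih₂ rfl with ⟨hw, -⟩ | ⟨_, _, h⟩
      · exact .inl ⟨.pair hv hw, _, _, rfl⟩
      · exact .inr ⟨_, _, .pairR hv h⟩
    · exact .inr ⟨_, _, .pairL h⟩
  | fst _ ih =>
    rcases ih hΨ with ⟨hv, V, W, rfl⟩ | ⟨_, _, h⟩
    · cases hv with | pair hv hw => exact .inr ⟨_, _, .fstPair hv hw⟩
    · exact .inr ⟨_, _, .fst h⟩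
  | snd _ ih =>
    rcases ih hΨ with ⟨hv, V, W, rfl⟩ | ⟨_, _, h⟩
    · cases hv with | pair hv hw => exact .inr ⟨_, _, .sndPair hv hw⟩
    · exact .inr ⟨_, _, .snd h⟩
  | int => exact .inl ⟨.int _, _, rfl⟩
  | bool => exact .inl ⟨.bool _, _, rfl⟩
  | ite hs _ _ _ ih =>
    subst hΨ
    obtain ⟨rfl, rfl⟩ := hs.eq_empty
    rcases ih rfl with ⟨-, b, rfl⟩ | ⟨_, _, h⟩
    · cases b
      · exact .inr ⟨_, _, .iteFalse⟩
      · exact .inr ⟨_, _, .iteTrue⟩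
    · exact .inr ⟨_, _, .ite h⟩
  | arith hs _ _ ih₁ ih₂ =>
    subst hΨ
    obtain ⟨rfl, rfl⟩ := hs.eq_empty
    rcases ih₁ rfl with ⟨hv, i, rfl⟩ | ⟨_, _, h⟩
    · rcases ih₂ rfl with ⟨-, j, rfl⟩ | ⟨_, _, h⟩
      · exact .inr ⟨_, _, .arith⟩
      · exact .inr ⟨_, _, .arithR hv h⟩
    · exact .inr ⟨_, _, .arithL h⟩
  | comp hs _ _ ih₁ ih₂ =>
    subst hΨ
    obtain ⟨rfl, rfl⟩ := hs.eq_empty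
    rcases ih₁ rfl with ⟨hv, i, rfl⟩ | ⟨_, _, h⟩
    · rcases ih₂ rfl with ⟨-, j, rfl⟩ | ⟨_, _, h⟩
      · exact .inr ⟨_, _, .comp⟩
      · exact .inr ⟨_, _, .compR hv h⟩
    · exact .inr ⟨_, _, .compL h⟩
  | nil => exact .inl ⟨.nil, .inl rfl⟩
  | cons hs _ _ ih₁ ih₂ =>
    subst hΨ
    obtain ⟨rfl, rfl⟩ := hs.eq_empty
    rcases ih₁ rfl with ⟨hv, -⟩ | ⟨_, _, h⟩
    · rcases ih₂ rfl with ⟨hw, -⟩ | ⟨_, _, h⟩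
      · exact .inl ⟨.cons hv hw, .inr ⟨_, _, rfl⟩⟩
      · exact .inr ⟨_, _, .consR hv h⟩
    · exact .inr ⟨_, _, .consL h⟩
  | lmatch hs _ _ _ _ ih =>
    subst hΨ
    obtain ⟨rfl, rfl⟩ := hs.eq_empty
    rcases ih rfl with ⟨hv, rfl | ⟨V, W, rfl⟩⟩ | ⟨_, _, h⟩
    · exact .inr ⟨_, _, .matchNil⟩
    · cases hv with | cons hv hw => exact .inr ⟨_, _, .matchCons hv hw⟩
    · exact .inr ⟨_, _, .lmatch h⟩
  | tick => exact .inr ⟨_, _, .tick⟩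
  | mon _ _ _ h₁ h₂ => exact .inl ⟨.mon _ _ _ _ _, _, _, _, _, rfl, h₁, h₂⟩
  | _ => trivial

/-! ## Inversion of process and message typing -/

/-- A set of channels with the shapes of their types. -/
abbrev ShapeCtx := Set (Chan × Shape)

/-- The shapes of a linear context. -/
def Sig.shapeCtx (Sg : Sig) (Δ : LCtx) : ShapeCtx :=
  {d | ∃ A, (d.1, A) ∈ Δ ∧ d.2 = Sg.shape A}

theorem Sig.shapeCtx_cons (Sg : Sig) (x : Chan) (A : SType) (Δ : LCtx) :
    Sg.shapeCtx ((x, A) ::ₘ Δ) = insert (x, Sg.shape A) (Sg.shapeCtx Δ) := by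
  ext ⟨y, s⟩
  simp only [Sig.shapeCtx, Multiset.mem_cons, Set.mem_ofPred_eq, Set.mem_insert_iff, Prod.mk.injEq]
  constructor
  · rintro ⟨B, ⟨rfl, rfl⟩ | h, rfl⟩
    · exact .inl ⟨rfl, rfl⟩
    · exact .inr ⟨B, h, rfl⟩
  · rintro (⟨rfl, rfl⟩ | ⟨B, h, rfl⟩)
    · exact ⟨A, .inl ⟨rfl, rfl⟩, rfl⟩
    · exact ⟨B, .inr h, rfl⟩

theorem Sig.mem_shapeCtx_self (Sg : Sig) (x : Chan) (A : SType) (Δ : LCtx) :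
    (x, Sg.shape A) ∈ Sg.shapeCtx ((x, A) ::ₘ Δ) :=
  ⟨A, Multiset.mem_cons_self _ _, rfl⟩

/-- What the typing of the process `P`, which provides `c` at a type of shape `s` and uses `D`, says
about its next action; `N` holds of the shared channels that `P` may refer to. -/
def ProcHead (Sg : Sig) (N : Ident → Prop) (D : ShapeCtx) (c : Chan) (s : Shape) : Proc → Prop
  | .spawn m _ M as ds _ => ExpProgress Sg M (.proc m as.length (ds.map Chan.mode))
  | .tail x M as ds => x = c ∧ ExpProgress Sg M (.proc c.mode as.length (ds.map Chan.mode))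
  | .fwd p x y => x = c ∧ y.mode = c.mode ∧ s.pol = some p ∧ (y, s) ∈ D
  | .sendLabel x _ _ => x = c ∨ ∃ t, (x, t) ∈ D
  | .case x L _ => (x = c ∧ s = .echoice L) ∨ (x, .ichoice L) ∈ D
  | .sendCh x _ _ => x = c ∨ ∃ t, (x, t) ∈ D
  | .recvCh x _ n _ => (x = c ∧ s = .lolli n) ∨ (x, .tensor n) ∈ D
  | .sendVal x M _ => (x = c ∨ ∃ t, (x, t) ∈ D) ∧ ∃ t, ExpProgress Sg M t
  | .recvVal x _ _ => (x = c ∧ s = .varrow) ∨ (x, .vtimes) ∈ D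
  | .close x => x = c
  | .wait x _ => (x, .one) ∈ D
  | .work _ _ => True
  | .get x r _ => (x = c ∧ s = .getpot r) ∨ (x, .paypot r) ∈ D
  | .pay x _ _ => x = c ∨ ∃ t, (x, t) ∈ D
  | .acquire _ x _ => x.mode = .S ∧ N x.id ∧ (c.mode = .L ∨ c.mode = .C)
  | .accept _ x _ => x = c ∧ c.mode = .S ∧ s = .up
  | .detach _ x _ => x = c ∧ c.mode = .L ∧ s = .down
  | .release _ x _ => x.mode = .L ∧ (x, .down) ∈ D

/-- Conversions may be stacked on either side before the rule for the next action, so inversion is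
an induction on the derivation. They leave all shapes unchanged, and every other rule can be read
off directly. -/
theorem ProcTyp.head {Sg : Sig} {Ψ : FCtx} {Γ : SCtx} {Δ : LCtx} {q : ℕ} {P : Proc} {c : Chan}
    {A : SType} (h : ProcTyp Sg Ψ Γ Δ q P c A) (hΨ : Ψ = FCtx.empty) {N : Ident → Prop}
    (hN : ∀ i B, Γ i = some B → N i) :
    ProcHead Sg N (Sg.shapeCtx Δ) c (Sg.shape A) P := by
  induction h using ProcTyp.rec (motive_1 := fun _ _ _ _ _ => True)
    (motive_3 := fun Ψ Γ Δ _ P c A _ => Ψ = FCtx.empty → (∀ i B, Γ i = some B → N i) →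
      ProcHead Sg N (Sg.shapeCtx Δ) c (Sg.shape A) P) with
  | mk _ _ ih => exact ih hΨ hN
  | convR _ he ih h₁ h₂ => rw [← he.shape_eq]; exact ih h₁ h₂
  | convL _ he ih h₁ h₂ =>
    rw [Sig.shapeCtx_cons, ← he.shape_eq, ← Sig.shapeCtx_cons]
    exact ih h₁ h₂
  | spawnR hs hd _ hM _ _ _ h =>
    subst h
    -- The expression to be evaluated is closed, so `ExpTyp.progress` applies to it.
    obtain ⟨rfl, rfl⟩ := hs.eq_empty
    simpa [Sig.unfoldF, FType.shape, ← hd, ProcHead] using hM.progress rfl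
  | spawnS hs _ hf hd _ _ hM _ _ _ h | spawnC hs _ hf hd hM _ _ _ h =>
    subst h
    obtain ⟨rfl, rfl⟩ := hs.eq_empty
    simpa [Sig.unfoldF, FType.shape, ← hd, ProcHead, hf.length_eq] using hM.progress rfl
  | tail hf hd hM _ h =>
    subst h
    exact ⟨rfl, by simpa [Sig.unfoldF, FType.shape, ← hd, hf.length_eq] using hM.progress rfl⟩
  | fwd _ hm hp =>
    exact ⟨rfl, hm, by rw [Sig.shape, SType.pol_shape]; exact hp, Sig.mem_shapeCtx_self _ _ _ 0⟩
  | plusR | tensorR | payR => exact Or.inl rfl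
  | withL | getL => exact Or.inr ⟨_, Sig.mem_shapeCtx_self _ _ _ _⟩
  | lolliL =>
    exact Or.inr ⟨_, _, Multiset.mem_cons_of_mem (Multiset.mem_cons_self _ _), rfl⟩
  | plusL | tensorL | timesL | payL => exact Or.inr (Sig.mem_shapeCtx_self _ _ _ _)
  | withR | lolliR | arrowR | getR => exact Or.inl ⟨rfl, rfl⟩
  | timesR hs hM _ _ _ h =>
    subst h
    obtain ⟨rfl, rfl⟩ := hs.eq_empty
    exact ⟨.inl rfl, _, hM.progress rfl⟩
  | arrowL hs hM _ _ _ h =>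
    subst h
    obtain ⟨rfl, rfl⟩ := hs.eq_empty
    exact ⟨.inr ⟨_, Sig.mem_shapeCtx_self _ _ _ _⟩, _, hM.progress rfl⟩
  | oneR => exact @rfl Chan _
  | oneL => exact Sig.mem_shapeCtx_self _ _ _ _
  | upR | downR => exact And.intro rfl ⟨rfl, rfl⟩
  | upL hz hΓ _ _ _ _ h => exact And.intro rfl ⟨h _ _ hΓ, hz⟩
  | downL => exact And.intro rfl (Sig.mem_shapeCtx_self _ _ _ _)
  | _ => trivial

/-- What the typing of the message `M`, which provides a channel at a type of shape `s` and uses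
`D`, says about its content. -/
def MsgHead (D : ShapeCtx) (s : Shape) : Msg → Prop
  | .out (.label k) _ => ∃ L, k ∈ L ∧ s = .ichoice L
  | .out (.chan w) _ => s = .tensor w.mode
  | .out (.val _) _ => s = .vtimes
  | .out (.pot r) _ => s = .paypot r
  | .inn (.label k) e => ∃ L, k ∈ L ∧ (e, .echoice L) ∈ D
  | .inn (.chan w) e => (e, .lolli w.mode) ∈ D
  | .inn (.val _) e => (e, .varrow) ∈ D
  | .inn (.pot r) e => (e, .getpot r) ∈ D
  | .close => s = .one

/-- As for processes, conversions do not affect shapes. A message to a client is described by the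
type it provides, a message to a provider by the type of the channel it uses. -/
theorem MsgRule.head {Sg : Sig} {Δ : LCtx} {q : ℕ} {M : Msg} {c : Chan} {A : SType}
    (h : MsgRule Sg Δ q M c A) : MsgHead (Sg.shapeCtx Δ) (Sg.shape A) M := by
  induction h with
  | convR _ he ih => rwa [← he.shape_eq]
  | convL _ he ih => rwa [Sig.shapeCtx_cons, ← he.shape_eq, ← Sig.shapeCtx_cons]
  | plus k hk => exact ⟨_, hk, rfl⟩
  | lolli => exact ⟨_, Multiset.mem_cons_of_mem (Multiset.mem_cons_self _ 0), rfl⟩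
  | arrow => exact Sig.mem_shapeCtx_self _ _ _ 0
  | get => exact Sig.mem_shapeCtx_self _ _ _ 0
  | _ => first | rfl | exact ⟨_, ‹_ ∈ _›, Sig.mem_shapeCtx_self _ _ _ 0⟩

/-- Only the closing message has no continuation; any other message uses a channel of the mode it
provides. This serves to show that messages never live at mode `S`. -/
theorem MsgRule.one_or_mode {Sg : Sig} {Δ : LCtx} {q : ℕ} {M : Msg} {c : Chan} {A : SType}
    (h : MsgRule Sg Δ q M c A) :
    Sg.shape A = .one ∨ ∃ d ∈ Δ.map Prod.fst, d.mode = c.mode := by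
  induction h with
  | convR _ he ih => rwa [← he.shape_eq]
  | convL _ he ih => simpa using ih
  | one => exact .inl rfl
  | _ => refine .inr ⟨_, ?_, ‹_ = _›⟩; simp


/-! ## Fresh channels -/

theorem Fresh.exists_name (a : ℕ) (m : Mode) (Ω : Cfg) : ∃ k, Fresh (ch a k m) Ω := by
  -- A configuration mentions finitely many stamps. The default `0` for variables is harmless: at
  -- worst it excludes one more stamp.
  obtain ⟨k, hk⟩ := Infinite.exists_notMem_finset
    ((Ω.map Obj.chans).sup.image fun c => match c.id with | .name _ k => k | .var _ => 0)
  refine ⟨k, fun o ho hc => hk (Finset.mem_image.2 ⟨ch a k m, ?_, rfl⟩)⟩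
  exact (Multiset.le_sup (Multiset.mem_map_of_mem Obj.chans ho) : o.chans ⊆ _) hc

theorem FreshBase.exists (Ω : Cfg) : ∃ a, FreshBase a Ω := by
  obtain ⟨a, ha⟩ := Infinite.exists_notMem_finset
    ((Ω.map Obj.chans).sup.image fun c => match c.id with | .name a _ => a | .var _ => 0)
  refine ⟨a, fun k m o ho hc => ha (Finset.mem_image.2 ⟨ch a k m, ?_, rfl⟩)⟩
  exact (Multiset.le_sup (Multiset.mem_map_of_mem Obj.chans ho) : o.chans ⊆ _) hc

/-! ## Typed objects -/

/-- What the typing of the object `o`, which provides a channel at a type of shape `s` and uses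
`D`, says about it; `N` holds of the shared channels that processes may refer to. -/
structure ObjInv (Sg : Sig) (N : Ident → Prop) (D : ShapeCtx) (o : Obj) (s : Shape) : Prop where
  named : ∃ a k, o.provides = ch a k o.provides.mode ∧ (o.provides.mode = .S → k = 0)
  pure : o.provides.mode = .R ∨ o.provides.mode = .S → ∀ d ∈ D, d.1.mode = .R
  notMem : ∀ t, (o.provides, t) ∉ D
  shared : o.provides.mode = .S → s = .up
  head : match o with
    | .proc c _ P => ProcHead Sg N D c s P
    | .msg _ _ M => MsgHead D s M

/-- The poised objects that provide `c` at a type of the given shape. -/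
def PoisedForm (c : Chan) (o : Obj) : Shape → Prop
  | .name _ => False
  | .ichoice L => ∃ w l c', l ∈ L ∧ o = .msg c w (.out (.label l) c')
  | .tensor n => ∃ w e c', n = e.mode ∧ o = .msg c w (.out (.chan e) c')
  | .one => ∃ w, o = .msg c w .close
  | .vtimes => ∃ w V c', o = .msg c w (.out (.val V) c')
  | .paypot r => ∃ w c', o = .msg c w (.out (.pot r) c')
  | .echoice L => (∃ w d, c.mode = d.mode ∧ o = .proc c w (.fwd .neg c d)) ∨
      ∃ w Q, o = .proc c w (.case c L Q)
  | .lolli n => (∃ w d, c.mode = d.mode ∧ o = .proc c w (.fwd .neg c d)) ∨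
      ∃ w x Q, o = .proc c w (.recvCh c x n Q)
  | .varrow => (∃ w d, c.mode = d.mode ∧ o = .proc c w (.fwd .neg c d)) ∨
      ∃ w x Q, o = .proc c w (.recvVal c x Q)
  | .getpot r => (∃ w d, c.mode = d.mode ∧ o = .proc c w (.fwd .neg c d)) ∨
      ∃ w Q, o = .proc c w (.get c r Q)
  | .up => ∃ a w y Q, c = sh a ∧ o = .proc (sh a) w (.accept y (sh a) Q)
  | .down => ∃ a k w y Q, c = ch a k .L ∧ o = .proc (ch a k .L) w (.detach y (ch a k .L) Q)

/-- A receiving action could a priori be typed by a left rule, on a channel that the process uses.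
Since a poised process receives along the channel it provides, and this channel is not among those
used, the right rule remains and fixes the shape. -/
theorem Poised.form {Sg : Sig} {N : Ident → Prop} {D : ShapeCtx} {o : Obj} {s : Shape}
    (hp : Poised o) (h : ObjInv Sg N D o s) : PoisedForm o.provides o s := by
  have hD := h.notMem
  have hh := h.head
  cases hp with
  | fwd c w d =>
    obtain ⟨-, hm, hs, -⟩ := hh
    -- Negative polarity leaves external choice, `lolli`, `varrow` and `getpot`, each of which
    -- admits a forwarder.
    cases s <;> first | cases hs; done | exact .inl ⟨_, _, hm.symm, rfl⟩
  | case =>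
    rcases hh with ⟨-, rfl⟩ | hh
    · exact .inr ⟨_, _, rfl⟩
    · exact (hD _ hh).elim
  | recvCh =>
    rcases hh with ⟨-, rfl⟩ | hh
    · exact .inr ⟨_, _, _, rfl⟩
    · exact (hD _ hh).elim
  | recvVal =>
    rcases hh with ⟨-, rfl⟩ | hh
    · exact .inr ⟨_, _, _, rfl⟩
    · exact (hD _ hh).elim
  | get =>
    rcases hh with ⟨-, rfl⟩ | hh
    · exact .inr ⟨_, _, rfl⟩
    · exact (hD _ hh).elim
  | accept =>
    obtain ⟨-, -, rfl⟩ := hh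
    exact ⟨_, _, _, _, rfl, rfl⟩
  | detach =>
    obtain ⟨-, -, rfl⟩ := hh
    exact ⟨_, _, _, _, _, rfl, rfl⟩
  | out c w pl c' =>
    cases pl with
    | label k => obtain ⟨L, hk, rfl⟩ := hh; exact ⟨_, _, _, hk, rfl⟩
    | chan e => cases hh; exact ⟨_, _, _, rfl, rfl⟩
    | val V => cases hh; exact ⟨_, _, _, rfl⟩
    | pot r => cases hh; exact ⟨_, _, rfl⟩
  | close => cases hh; exact ⟨_, rfl⟩

/-- Brings two interacting objects to the front, as the rewriting rules require. Being distinct,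
they cannot be one and the same occurrence. -/
theorem Cfg.exists_cons_cons {Ω : Cfg} {o o' : Obj} (h : o ∈ Ω) (h' : o' ∈ Ω) (hne : o ≠ o') :
    ∃ Θ, Ω = o ::ₘ o' ::ₘ Θ := by
  obtain ⟨Θ, rfl⟩ := Multiset.exists_cons_of_mem h
  obtain ⟨Θ', rfl⟩ := Multiset.exists_cons_of_mem
    ((Multiset.mem_cons.1 h').resolve_left hne.symm)
  exact ⟨Θ', rfl⟩

/-- An object of a configuration that cannot move is poised, if the objects that it depends on
are. -/
theorem ObjInv.poised {Sg : Sig} {N : Ident → Prop} {Ω : Cfg} (hns : ¬ ∃ Ω', Step Sg Ω Ω')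
    {D : ShapeCtx} {o : Obj} {s : Shape} (h : ObjInv Sg N D o s) (ho : o ∈ Ω)
    (hD : ∀ d ∈ D, ∃ o' ∈ Ω, o'.provides = d.1 ∧ Poised o' ∧ ∃ D', ObjInv Sg N D' o' d.2)
    (hacq : ∀ c w y i Q, o = .proc c w (.acquire y ⟨i, .S⟩ Q) → N i → c.mode = .L ∨ c.mode = .C →
      False) : Poised o := by
  by_contra hpo
  apply hns
  -- Each channel in use has a poised provider, whose form is dictated by the shape at which the
  -- channel is used.
  have hform : ∀ d ∈ D, (∃ a k, d.1 = ch a k d.1.mode) ∧ ∃ o' ∈ Ω, PoisedForm d.1 o' d.2 := by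
    intro d hd
    obtain ⟨o', ho', hc, hp, D', hi⟩ := hD d hd
    have := hp.form hi
    obtain ⟨a, k, hak, -⟩ := hi.named
    rw [hc] at this hak
    exact ⟨⟨a, k, hak⟩, o', ho', this⟩
  have hnot := h.notMem
  have hh := h.head
  obtain ⟨a, k, hak, -⟩ := h.named
  -- Channels along which the object can send are run-time names, so that a continuation with a
  -- fresh stamp makes sense.
  have hname : ∀ x, x = o.provides ∨ (∃ t, (x, t) ∈ D) → (∃ b j n, x = ch b j n) := by
    rintro x (rfl | ⟨t, ht⟩)
    · exact ⟨_, _, _, hak⟩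
    · obtain ⟨⟨b, j, hb⟩, -⟩ := hform _ ht
      exact ⟨_, _, _, hb⟩
  cases o with
  | msg c w M =>
    cases M with
    | out pl c' => exact (hpo (.out _ _ _ _)).elim
    | close => exact (hpo (.close _ _)).elim
    | inn pl e =>
      cases pl with
      | label l =>
        obtain ⟨L, hl, hd⟩ := hh
        -- The poised provider of a negative type is either a forwarder, which absorbs the message,
        -- or a process ready to receive it. Both sides agree on the label set `L`, so the label has
        -- a branch.
        obtain ⟨-, o', ho', ⟨w', d, hm, rfl⟩ | ⟨w', Q, rfl⟩⟩ := hform _ hd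
        · obtain ⟨Θ, rfl⟩ := Cfg.exists_cons_cons ho' ho (by simp)
          exact ⟨_, .fwdNeg hm (by simp [Msg.used])⟩
        · obtain ⟨Θ, rfl⟩ := Cfg.exists_cons_cons ho' ho (by simp)
          exact ⟨_, .withC hl⟩
      | chan x =>
        obtain ⟨-, o', ho', ⟨w', d, hm, rfl⟩ | ⟨w', y, Q, rfl⟩⟩ := hform _ hh
        · obtain ⟨Θ, rfl⟩ := Cfg.exists_cons_cons ho' ho (by simp)
          exact ⟨_, .fwdNeg hm (by simp [Msg.used])⟩
        · obtain ⟨Θ, rfl⟩ := Cfg.exists_cons_cons ho' ho (by simp)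
          exact ⟨_, .lolliC⟩
      | val V =>
        obtain ⟨-, o', ho', ⟨w', d, hm, rfl⟩ | ⟨w', y, Q, rfl⟩⟩ := hform _ hh
        · obtain ⟨Θ, rfl⟩ := Cfg.exists_cons_cons ho' ho (by simp)
          exact ⟨_, .fwdNeg hm (by simp [Msg.used])⟩
        · obtain ⟨Θ, rfl⟩ := Cfg.exists_cons_cons ho' ho (by simp)
          exact ⟨_, .arrowC⟩
      | pot r =>
        obtain ⟨-, o', ho', ⟨w', d, hm, rfl⟩ | ⟨w', Q, rfl⟩⟩ := hform _ hh
        · obtain ⟨Θ, rfl⟩ := Cfg.exists_cons_cons ho' ho (by simp)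
          exact ⟨_, .fwdNeg hm (by simp [Msg.used])⟩
        · obtain ⟨Θ, rfl⟩ := Cfg.exists_cons_cons ho' ho (by simp)
          exact ⟨_, .getC⟩
  | proc c w P =>
    obtain ⟨Θ, hΘ⟩ := Multiset.exists_cons_of_mem ho
    cases P with
    | spawn m x M as ds Q =>
      subst hΘ
      rcases hh with ⟨-, x', ys, zs, P, rfl, h₁, h₂⟩ | ⟨_, _, hs⟩
      · obtain ⟨b, hb⟩ := FreshBase.exists
          (.proc c w (.spawn m x (.mon m x' ys zs P) as ds Q) ::ₘ Θ)
        exact ⟨_, .spawn b hb h₁ h₂⟩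
      · exact ⟨_, .internalSpawn hs⟩
    | tail x M as ds =>
      subst hΘ
      obtain ⟨rfl, ⟨-, x', ys, zs, P, rfl, h₁, h₂⟩ | ⟨_, _, hs⟩⟩ := hh
      · exact ⟨_, .tail h₁ h₂⟩
      · exact ⟨_, .internalTail hs⟩
    | fwd p x y =>
      obtain ⟨rfl, hm, hs, hd⟩ := hh
      cases p with
      | neg => exact (hpo (.fwd _ _ _)).elim
      | pos =>
        -- At a positive shape, every poised provider is a message, which the forwarder can pass on.
        have : ∃ w' M, Obj.msg y w' M ∈ Ω := by
          obtain ⟨-, o', ho', hf⟩ := hform _ hd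
          cases s <;> first | cases hs; done | skip
          · obtain ⟨_, _, _, -, rfl⟩ := hf; exact ⟨_, _, ho'⟩
          · obtain ⟨_, _, _, -, rfl⟩ := hf; exact ⟨_, _, ho'⟩
          · obtain ⟨_, rfl⟩ := hf; exact ⟨_, _, ho'⟩
          · obtain ⟨_, _, _, rfl⟩ := hf; exact ⟨_, _, ho'⟩
          · obtain ⟨_, _, rfl⟩ := hf; exact ⟨_, _, ho'⟩
        obtain ⟨w', M, ho'⟩ := this
        obtain ⟨Θ, rfl⟩ := Cfg.exists_cons_cons ho' ho (by simp)
        exact ⟨_, .fwdPos hm.symm⟩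
    | sendLabel x l P =>
      subst hΘ
      obtain ⟨b, j, n, rfl⟩ := hname x hh
      obtain ⟨k', hk'⟩ := Fresh.exists_name b n (.proc c w (.sendLabel (ch b j n) l P) ::ₘ Θ)
      -- Sending never waits. Along the provided channel the message goes out to the client; along
      -- any other it goes in to the provider.
      by_cases hc : c = ch b j n
      · subst hc; exact ⟨_, .plusS k' hk'⟩
      · exact ⟨_, .withS k' hc hk'⟩
    | case x L Q =>
      rcases hh with ⟨rfl, -⟩ | hd
      · exact (hpo (.case _ _ _ _)).elim
      · obtain ⟨-, o', ho', w', l, c', hl, rfl⟩ := hform _ hd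
        obtain ⟨Θ, rfl⟩ := Cfg.exists_cons_cons ho' ho (by simp)
        exact ⟨_, .plusC hl⟩
    | sendCh x e P =>
      subst hΘ
      obtain ⟨b, j, n, rfl⟩ := hname x hh
      obtain ⟨k', hk'⟩ := Fresh.exists_name b n (.proc c w (.sendCh (ch b j n) e P) ::ₘ Θ)
      by_cases hc : c = ch b j n
      · subst hc; exact ⟨_, .tensorS k' hk'⟩
      · exact ⟨_, .lolliS k' hc hk'⟩
    | recvCh x y n Q =>
      rcases hh with ⟨rfl, -⟩ | hd
      · exact (hpo (.recvCh _ _ _ _ _)).elim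
      · obtain ⟨-, o', ho', w', e, c', rfl, rfl⟩ := hform _ hd
        obtain ⟨Θ, rfl⟩ := Cfg.exists_cons_cons ho' ho (by simp)
        exact ⟨_, .tensorC⟩
    | sendVal x M P =>
      subst hΘ
      obtain ⟨hx, t, ⟨hv, -⟩ | ⟨_, _, hs⟩⟩ := hh
      · obtain ⟨b, j, n, rfl⟩ := hname x hx
        obtain ⟨k', hk'⟩ := Fresh.exists_name b n (.proc c w (.sendVal (ch b j n) M P) ::ₘ Θ)
        by_cases hc : c = ch b j n
        · subst hc; exact ⟨_, .timesS k' hv hk'⟩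
        · exact ⟨_, .arrowS k' hv hc hk'⟩
      · exact ⟨_, .internalSend hs⟩
    | recvVal x y Q =>
      rcases hh with ⟨rfl, -⟩ | hd
      · exact (hpo (.recvVal _ _ _ _)).elim
      · obtain ⟨-, o', ho', w', V, c', rfl⟩ := hform _ hd
        obtain ⟨Θ, rfl⟩ := Cfg.exists_cons_cons ho' ho (by simp)
        exact ⟨_, .timesC⟩
    | close x => subst hΘ; cases hh; exact ⟨_, .oneS⟩
    | wait x Q =>
      obtain ⟨-, o', ho', w', rfl⟩ := hform _ hh
      obtain ⟨Θ, rfl⟩ := Cfg.exists_cons_cons ho' ho (by simp)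
      exact ⟨_, .oneC⟩
    | work r P => subst hΘ; exact ⟨_, .work⟩
    | get x r Q =>
      rcases hh with ⟨rfl, -⟩ | hd
      · exact (hpo (.get _ _ _ _)).elim
      · obtain ⟨-, o', ho', w', c', rfl⟩ := hform _ hd
        obtain ⟨Θ, rfl⟩ := Cfg.exists_cons_cons ho' ho (by simp)
        exact ⟨_, .payC⟩
    | pay x r P =>
      subst hΘ
      obtain ⟨b, j, n, rfl⟩ := hname x hh
      obtain ⟨k', hk'⟩ := Fresh.exists_name b n (.proc c w (.pay (ch b j n) r P) ::ₘ Θ)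
      by_cases hc : c = ch b j n
      · subst hc; exact ⟨_, .payS k' hk'⟩
      · exact ⟨_, .getS k' hc hk'⟩
    | acquire y x Q =>
      obtain ⟨i, m⟩ := x
      obtain ⟨rfl, hN, hc⟩ := hh
      -- The only action whose partner is not found among the providers of `D`.
      exact (hacq _ _ _ _ _ rfl hN hc).elim
    | accept y x P =>
      obtain ⟨rfl, hm, -⟩ := hh
      obtain ⟨a, k, hc, hk⟩ := h.named
      change x = _ at hc
      change x.mode = _ → _ at hk
      -- Run-time shared channels carry stamp `0`, so the provided channel is `sh a`, as poised
      -- accepting demands.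
      rw [hk hm] at hc
      change x = ch a 0 x.mode at hc
      rw [hm] at hc
      rw [hc] at hpo
      exact (hpo (.accept _ _ _ _)).elim
    | detach y x P =>
      obtain ⟨rfl, hm, -⟩ := hh
      change x = ch a k x.mode at hak
      rw [hm] at hak
      rw [hak] at hpo
      exact (hpo (.detach _ _ _ _ _)).elim
    | release y x Q =>
      -- A poised provider at shape `down` must be detaching, which is the partner of a release.
      obtain ⟨-, o', ho', b, j, w', z, P, hx, rfl⟩ := hform _ hh.2
      change x = _ at hx
      subst hx
      obtain ⟨Θ, rfl⟩ := Cfg.exists_cons_cons ho' ho (by simp)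
      exact ⟨_, .downC⟩

/-! ## Typed configurations -/

/-- Configurations of typed objects in which each object uses only channels that are provided
by objects below it; the channels in `D` are offered to the outside. -/
inductive Forest (Sg : Sig) (N : Ident → Prop) : Cfg → ShapeCtx → Prop
  | emp : Forest Sg N 0 ∅
  | cons {Ω D D' E o s} : Forest Sg N Ω D → D' ⊆ D → ObjInv Sg N D' o s →
      (∀ d ∈ E, d ∈ D ∨ d = (o.provides, s) ∧ d.1.mode ≠ .S) → Forest Sg N (o ::ₘ Ω) E

/-- The shared channels that are assigned a type. -/
def IsGlobal (Γ₀ : ℕ → Option SType) (i : Ident) : Prop := ∃ a A, i = .name a 0 ∧ Γ₀ a = some A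

theorem isGlobal_of_ofGlobal {Γ₀ : ℕ → Option SType} {i : Ident} {B : SType}
    (h : SCtx.ofGlobal Γ₀ i = some B) : IsGlobal Γ₀ i := by
  unfold SCtx.ofGlobal at h
  split at h
  · exact ⟨_, _, rfl, h⟩
  · cases h

theorem Inv.notMem_shapeCtx {Sg : Sig} {Γ : SCtx} {Δ : LCtx} {c : Chan} {A : SType}
    (h : Inv Sg Γ Δ c A) (t : Shape) : (c, t) ∉ Sg.shapeCtx Δ := by
  rintro ⟨B, hB, -⟩
  exact (Multiset.nodup_cons.1 h.nodup).1 (Multiset.mem_map_of_mem Prod.fst hB)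

theorem Inv.pure_shapeCtx {Sg : Sig} {Γ : SCtx} {Δ : LCtx} {c : Chan} {A : SType}
    (h : Inv Sg Γ Δ c A) (hc : c.mode = .R ∨ c.mode = .S) :
    ∀ d ∈ Sg.shapeCtx Δ, d.1.mode = .R := by
  rintro ⟨d, _⟩ ⟨B, hB, -⟩
  exact h.pure hc _ hB

theorem ProcTyp.objInv {Sg : Sig} {Γ : SCtx} {Δ : LCtx} {q w : ℕ} {P : Proc} {a k : ℕ} {m : Mode}
    {A : SType} {N : Ident → Prop} (h : ProcTyp Sg FCtx.empty Γ Δ q P (ch a k m) A)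
    (hN : ∀ i B, Γ i = some B → N i) (hk : m = .S → k = 0) :
    ObjInv Sg N (Sg.shapeCtx Δ) (.proc (ch a k m) w P) (Sg.shape A) := by
  have hi : Inv Sg Γ Δ (ch a k m) A := by cases h; assumption
  refine ⟨⟨a, k, rfl, hk⟩, hi.pure_shapeCtx, hi.notMem_shapeCtx, ?_, h.head rfl hN⟩
  intro hm
  have := hi.lang
  rw [show (ch a k m).mode = .S from hm] at this
  exact this.shape_eq_up

/-- At mode `S` the type would have shape `up`, so the message is not the closing one; then it uses
a channel of mode `S`, but contexts contain only linear channels. -/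
theorem MsgRule.mode_ne {Sg : Sig} {Γ : SCtx} {Δ : LCtx} {q : ℕ} {M : Msg} {c : Chan} {A : SType}
    (h : MsgRule Sg Δ q M c A) (hi : Inv Sg Γ Δ c A) : c.mode ≠ .S := by
  intro hm
  rcases h.one_or_mode with h | ⟨d, hd, h⟩
  · have := hi.lang
    rw [hm] at this
    simp [this.shape_eq_up] at h
  · obtain ⟨p, hp, rfl⟩ := Multiset.mem_map.1 hd
    exact hi.linear _ hp (h.trans hm)

theorem MsgRule.objInv {Sg : Sig} {Γ : SCtx} {Δ : LCtx} {q w : ℕ} {M : Msg} {a k : ℕ} {m : Mode}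
    {A : SType} (N : Ident → Prop) (h : MsgRule Sg Δ q M (ch a k m) A)
    (hi : Inv Sg Γ Δ (ch a k m) A) :
    ObjInv Sg N (Sg.shapeCtx Δ) (.msg (ch a k m) w M) (Sg.shape A) :=
  ⟨⟨a, k, rfl, fun hm => (h.mode_ne hi hm).elim⟩, hi.pure_shapeCtx, hi.notMem_shapeCtx,
    fun hm => (h.mode_ne hi hm).elim, h.head⟩

theorem Sig.shapeCtx_mono (Sg : Sig) {Δ Δ' : LCtx} (h : Δ ≤ Δ') :
    Sg.shapeCtx Δ ⊆ Sg.shapeCtx Δ' :=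
  fun _ ⟨A, hA, hs⟩ => ⟨A, Multiset.mem_of_le h hA, hs⟩

/-- Each typing rule puts one object on top of a configuration offering `Δ + Δ'`: the object uses
`Δ'`, and `Δ` remains offered. Passing to sets of shapes forgets that each offer is consumed once,
which progress does not need. -/
theorem CfgTyp.forest {Sg : Sig} {Γ₀ : ℕ → Option SType} {E : ℕ} {Ω : Cfg}
    {Γ : Multiset (ℕ × SType)} {Δ : LCtx} (h : CfgTyp Sg Γ₀ E Ω Γ Δ) :
    Forest Sg (IsGlobal Γ₀) Ω (Sg.shapeCtx Δ) := by
  have hcons : ∀ {Δ Δ' : LCtx} {c : Chan} {A : SType}, c.mode ≠ .S →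
      ∀ d ∈ Sg.shapeCtx ((c, A) ::ₘ Δ),
        d ∈ Sg.shapeCtx (Δ + Δ') ∨ d = (c, Sg.shape A) ∧ d.1.mode ≠ .S := by
    intro Δ Δ' c A hc d hd
    rw [Sig.shapeCtx_cons] at hd
    rcases hd with rfl | hd
    · exact .inr ⟨rfl, hc⟩
    · exact .inl (Sg.shapeCtx_mono (Multiset.le_add_right _ _) hd)
  have hsub : ∀ {Δ Δ' : LCtx}, Sg.shapeCtx Δ' ⊆ Sg.shapeCtx (Δ + Δ') :=
    fun {_ _} => Sg.shapeCtx_mono (Multiset.le_add_left _ _)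
  induction h with
  | emp =>
    have : Sg.shapeCtx 0 = ∅ := by
      ext d
      simp [Sig.shapeCtx]
    rw [this]
    exact .emp
  | procR _ hP ih =>
    exact ih.cons hsub (hP.objInv (by simp [SCtx.empty]) (by simp)) (hcons (by simp))
  | procS _ _ _ hP ih =>
    -- A process in shared mode adds no linear channel to the offer.
    exact ih.cons hsub (hP.objInv (fun _ _ => isGlobal_of_ofGlobal) (by simp))
      fun d hd => .inl (Sg.shapeCtx_mono (Multiset.le_add_right _ _) hd)
  | procL _ _ _ hP ih =>
    exact ih.cons hsub (hP.objInv (fun _ _ => isGlobal_of_ofGlobal) (by simp)) (hcons (by simp))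
  | procC _ hP ih =>
    exact ih.cons hsub (hP.objInv (fun _ _ => isGlobal_of_ofGlobal) (by simp)) (hcons (by simp))
  | msg _ hi hM ih => exact ih.cons hsub (hM.objInv _ hi) (hcons (hM.mode_ne hi))

/-- Only the rules for processes in shared mode and in the linear phase extend `Γ`, and each does so
for the process it adds. This dichotomy separates a possible synchronization from a blocked acquire.
-/
theorem CfgTyp.exists_provider {Sg : Sig} {Γ₀ : ℕ → Option SType} {E : ℕ} {Ω : Cfg}
    {Γ : Multiset (ℕ × SType)} {Δ : LCtx} (h : CfgTyp Sg Γ₀ E Ω Γ Δ) :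
    ∀ p ∈ Γ, (∃ w P, Obj.proc (sh p.1) w P ∈ Ω) ∨ ∃ k w P, Obj.proc (ch p.1 k .L) w P ∈ Ω := by
  have hcons : ∀ {Ω : Cfg} {a : ℕ} (o : Obj),
      ((∃ w P, Obj.proc (sh a) w P ∈ Ω) ∨ ∃ k w P, Obj.proc (ch a k .L) w P ∈ Ω) →
      (∃ w P, Obj.proc (sh a) w P ∈ o ::ₘ Ω) ∨ ∃ k w P, Obj.proc (ch a k .L) w P ∈ o ::ₘ Ω := by
    rintro Ω a o (⟨w, P, h⟩ | ⟨k, w, P, h⟩)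
    · exact .inl ⟨w, P, Multiset.mem_cons_of_mem h⟩
    · exact .inr ⟨k, w, P, Multiset.mem_cons_of_mem h⟩
  induction h with
  | emp => simp
  | procR _ _ ih | procC _ _ ih | msg _ _ _ ih => exact fun p hp => hcons _ (ih p hp)
  | procS _ _ _ _ ih =>
    intro p hp
    rcases Multiset.mem_cons.1 hp with rfl | hp
    · exact .inl ⟨_, _, Multiset.mem_cons_self _ _⟩
    · exact hcons _ (ih p hp)
  | procL _ _ _ _ ih =>
    intro p hp
    rcases Multiset.mem_cons.1 hp with rfl | hp
    · exact .inr ⟨_, _, _, Multiset.mem_cons_self _ _⟩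
    · exact hcons _ (ih p hp)

theorem Forest.exists_objInv {Sg : Sig} {N : Ident → Prop} {Ω : Cfg} {D : ShapeCtx}
    (h : Forest Sg N Ω D) : ∀ o ∈ Ω, ∃ D s, ObjInv Sg N D o s := by
  induction h with
  | emp => simp
  | cons _ _ hi _ ih =>
    intro o ho
    rcases Multiset.mem_cons.1 ho with rfl | ho
    · exact ⟨_, _, hi⟩
    · exact ih o ho

theorem Forest.exists_offer {Sg : Sig} {N : Ident → Prop} {Ω : Cfg} {D : ShapeCtx}
    (h : Forest Sg N Ω D) : ∀ d ∈ D, ∃ o ∈ Ω, o.provides = d.1 ∧ ∃ D', ObjInv Sg N D' o d.2 := by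
  induction h with
  | emp => simp
  | cons _ _ hi hE ih =>
    intro d hd
    rcases hE d hd with hd | ⟨rfl, -⟩
    · obtain ⟨o, ho, h⟩ := ih d hd
      exact ⟨o, Multiset.mem_cons_of_mem ho, h⟩
    · exact ⟨_, Multiset.mem_cons_self _ _, rfl, _, hi⟩

/-- In a configuration that cannot move, the objects with modes in a set `T` are poised, if none of
them tries to acquire a channel and if with every mode `T` contains those it may depend on. -/
theorem Forest.poised {Sg : Sig} {N : Ident → Prop} {Ω₀ Ω : Cfg} {D : ShapeCtx}
    (h : Forest Sg N Ω D) (hns : ¬ ∃ Ω', Step Sg Ω₀ Ω') (hΩ : Ω ⊆ Ω₀) (T : Set Mode)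
    (hR : .R ∈ T) (hT : .L ∈ T ∨ .C ∈ T → ∀ m, m ∈ T)
    (hacq : ∀ c w y i Q, Obj.proc c w (.acquire y ⟨i, .S⟩ Q) ∈ Ω₀ → N i →
      c.mode = .L ∨ c.mode = .C → c.mode ∈ T → False) :
    ∀ o ∈ Ω, o.provides.mode ∈ T → Poised o := by
  -- The induction runs over subconfigurations `Ω`, while `Ω₀` stays fixed: being unable to move
  -- concerns the whole configuration.
  induction h with
  | emp => simp
  | @cons Ω D D' E o s hF hD' hi _ ih =>
    obtain ⟨ho, hΩ'⟩ := Multiset.cons_subset.1 hΩ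
    specialize ih hΩ'
    intro o' ho' hm
    rcases Multiset.mem_cons.1 ho' with rfl | ho'
    · refine hi.poised hns ho ?_ ?_
      · intro d hd
        obtain ⟨o, hoΩ, hc, h⟩ := hF.exists_offer d (hD' hd)
        refine ⟨o, hΩ' hoΩ, hc, ih o hoΩ ?_, h⟩
        rw [hc]
        -- Objects at modes `R` and `S` depend only on mode `R`. Those at `L` and `C` may depend on
        -- anything, so `T` must then be everything.
        have hp := hi.pure
        revert hm hp
        generalize o'.provides.mode = m
        intro hm hp
        cases m with
        | R => rw [hp (.inl rfl) d hd]; exact hR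
        | S => rw [hp (.inr rfl) d hd]; exact hR
        | L => exact hT (.inl hm) _
        | C => exact hT (.inr hm) _
      · rintro c w y i Q rfl hN hc
        exact hacq _ _ _ _ _ ho hN hc hm
    · exact ih o' ho' hm

end Nomos

-- The progress theorem

open Nomos in
theorem theorem2 (Sg : Sig) (hSg : Sg.WellFormed) (Γ₀ : ℕ → Option SType) (E : ℕ) (Ω : Cfg)
    (Γ : Multiset (ℕ × SType)) (Δ : LCtx)
    (htyped : CfgTyp Sg Γ₀ E Ω Γ Δ) (hwf : WellFormed Γ₀ Ω Γ Δ) (hclosed : Closed Γ₀ Γ) :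
    (∀ o ∈ Ω, Poised o) ∨ (∃ Ω', Step Sg Ω Ω') ∨
      ∃ a, (∃ c, Acquiring Ω c a) ∧ ∃ k w P, Obj.proc (ch a k .L) w P ∈ Ω := by
  by_contra! hcon
  obtain ⟨⟨o, ho, hpo⟩, hns, hblock⟩ := hcon
  have hns : ¬ ∃ Ω', Step Sg Ω Ω' := fun ⟨Ω', h⟩ => hns Ω' h
  have hF := htyped.forest
  -- First run: at modes `R` and `S` nothing can acquire, so these objects are poised
  -- unconditionally.
  have hS := hF.poised hns (fun _ h => h) {.R, .S} (by simp) (by simp) (by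
    rintro ⟨i, m⟩ w y j Q - - (rfl | rfl) <;> simp)
  -- Second run, over all modes; what remains is to refute an acquire of a shared channel with a
  -- global type.
  refine hpo (hF.poised hns (fun _ h => h) Set.univ trivial (fun _ _ => trivial) ?_ o ho trivial)
  rintro c w y i Q hacq ⟨a, A, rfl, hA⟩ - -
  rcases htyped.exists_provider _ (hclosed a A hA) with ⟨w', P, hP⟩ | ⟨k, w', P, hP⟩
  · have hp := hS _ hP (by simp [Obj.provides])
    obtain ⟨D, s, hi⟩ := hF.exists_objInv _ hP
    have hform := hp.form hi
    -- The provider has a type of shape `up`, so being poised it accepts, and together with the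
    -- acquiring process it can step.
    rw [hi.shared rfl] at hform
    obtain ⟨b, w₁, z, P', hb, hP'⟩ := hform
    cases hb
    cases hP'
    obtain ⟨Θ, rfl⟩ := Cfg.exists_cons_cons hP hacq (by simp)
    obtain ⟨k, hk⟩ := Fresh.exists_name a .L _
    exact hns ⟨_, .upC k hk⟩
  · exact hblock a ⟨c, w, y, Q, hacq⟩ k w' P hP
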